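/- Let $n\ge 1$, $0<p<1$, and $\sigma\in J_n^+:=\{0\}\cup[(2-n)_+,\infty)$, where $s_+=\max\{s,0\}$. Let $\Lambda:[0,\infty)\to[0,\infty)$ be continuous with $\Lambda(t)>0$ for $t>0$, and put $\Lambda_*(t)=\int_0^t\Lambda(\tau)\,d\tau$. Let $V\ge 0$ be continuous on $\mathbb{R}^n\times(0,\infty)$ and assume that there are $c>0$ and $R_0$ with $$V(x,t)\ge c\,\Lambda(t)|x|^{\sigma}\qquad(|x|\ge R_0,\ t>0).$$ For $R>0$ and $a\in\mathbb{R}$ let $\|\varphi\|_{R,a}=\|(R^2+|\cdot|^2)^{-a/2}\varphi\|_{L^\infty(\mathbb{R}^n)}\in[0,\infty]$, and let $BC_a$ be the space of continuous $\varphi$ on $\mathbb{R}^n$ with $|\varphi(x)|\le \mathrm{const}\cdot|x|^a$ as $|x|\to\infty$, normed by $\|\cdot\|_{1,a}$. Let $\mathcal{B}=(1-\Delta)^{-1}$ be the Bessel potential operator, i.e. convolution with $B(x)=\int_0^\infty e^{-s}(4\pi s)^{-n/2}e^{-|x|^2/(4s)}\,ds$. For $u_0\ge0$ continuous on $\mathbb{R}^n$,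 a global s-solution of $$\partial_tu-\Delta\partial_tu=\Delta u+V(x,t)u^p\ \ (x\in\mathbb{R}^n,\,t>0),\qquad u(\cdot,0)=u_0,$$ is a function $u\ge0$ on $\mathbb{R}^n\times[0,\infty)$ such that $\mu=e^tu\in C([0,\infty);BC_b)$ for some $b\in\mathbb{R}$ and, for all $x\in\mathbb{R}^n$ and $t\ge0$, $$\mu(x,t)=u_0(x)+\int_0^t\mathcal{B}\mu(x,\tau)\,d\tau+\int_0^te^{(1-p)\tau}\mathcal{B}[V\mu^p](x,\tau)\,d\tau,$$ where the last integral is required to converge. Let $a\ge\sigma_+/(1-p)$ and $R>0$. (1) If $\sigma>0$, assume in addition that $\Lambda\in\mathcal{E}_\varepsilon$ for some $\varepsilon\in(0,1)$, i.e. that there are $c',t_0>0$ with $\Lambda_*(\varepsilon t)\ge c'\Lambda_*(t)$ for all $t\ge\varepsilon^{-1}t_0$. Then there are $C,T>0$ such that for every continuous $u_0\ge0$ with $u_0\not\equiv0$, every global s-solution $u$ and all $t\ge T$, $$u(x,t)\ge C\,\Lambda_*(t)^{\frac1{1-p}}(1+t+|x|^2)^{\frac{\sigma}{2(1-p)}}\quad(x\in\mathbb{R}^n),\qquad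 \|u(\cdot,t)\|_{R,a}\ge C\,\Lambda_*(t)^{\frac1{1-p}}t^{\frac{\sigma}{2(1-p)}}.$$ (2) Let $k,\nu\in\mathbb{R}$ and suppose that $\Lambda(t)$ is bounded above and below by positive constant multiples of $t^k(\log t)^\nu$ for all large $t$. Put $$\Lambda_{*,k,\nu}(t)=\begin{cases}\log(\log t)&k=\nu=-1,\\(\log t)^{(\nu+1)_+}&k=-1,\ \nu\ne-1,\\ \bigl(t(\log t)^{\frac{\nu}{k+1}}\bigr)^{(k+1)_+}&k\neq-1.\end{cases}$$ Then there are $C,T>0$ such that for every continuous $u_0\ge0$ with $u_0\not\equiv0$, every global s-solution $u$ and all $t\ge T$, $$u(x,t)\ge C\,\Lambda_{*,k,\nu}(t)^{\frac1{1-p}}(1+t+|x|^2)^{\frac{\sigma}{2(1-p)}}\quad(x\in\mathbb{R}^n),$$ $$\|u(\cdot,t)\|_{R,a}\ge C\begin{cases}(\log(\log t))^{\frac1{1-p}}\,t^{\frac{\sigma}{2(1-p)}}&k=\nu=-1,\\(\log t)^{\frac{(\nu+1)_+}{1-p}}\,t^{\frac{\sigma}{2(1-p)}}&k=-1,\ \nu\neq-1,\\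 t^{\frac{\sigma+2(k+1)_+}{2(1-p)}}(\log t)^{\frac{\delta\nu}{1-p}}&k\neq-1,\end{cases}$$ where $\delta=1$ if $k>-1$ and $\delta=0$ if $k<-1$. -/

import Mathlib

open MeasureTheory Set Filter Topology Asymptotics

noncomputable section

/-- The Bessel potential kernel of `(1 - Δ)⁻¹` on `ℝⁿ`, written as the Laplace transform at `1` of
the heat kernel: `B(x) = ∫₀^∞ e^{-s} (4πs)^{-n/2} e^{-|x|²/(4s)} ds`. Its Fourier transform is
`1 / (1 + |ξ|²)` and its total mass is `1`. -/
def besselKernel (n : ℕ) (x : EuclideanSpace ℝ (Fin n)) : ℝ :=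
  ∫ s in Ioi (0 : ℝ),
    Real.exp (-s) * ((4 * Real.pi * s) ^ (-(n : ℝ) / 2) * Real.exp (-‖x‖ ^ 2 / (4 * s)))

/-- The Bessel potential operator `𝓑 φ = (1 - Δ)⁻¹ φ = B ∗ φ`. -/
def besselPotential (n : ℕ) (φ : EuclideanSpace ℝ (Fin n) → ℝ)
    (x : EuclideanSpace ℝ (Fin n)) : ℝ :=
  ∫ y, besselKernel n (x - y) * φ y

/-- The weighted norm `‖φ‖_{R,a} = ‖(R² + |·|²)^{-a/2} φ‖_{L^∞}`, with values in `[0, ∞]`. -/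
def weightedNorm (n : ℕ) (R a : ℝ) (φ : EuclideanSpace ℝ (Fin n) → ℝ) : ENNReal :=
  eLpNorm (fun x => (R ^ 2 + ‖x‖ ^ 2) ^ (-a / 2) * φ x) ⊤ volume

/-- The space `BC_a` of continuous functions with `|φ(x)| ≤ const · |x|^a` as `|x| → ∞`. -/
def MemBC (n : ℕ) (a : ℝ) (φ : EuclideanSpace ℝ (Fin n) → ℝ) : Prop :=
  Continuous φ ∧ ∃ M r : ℝ, ∀ x, r ≤ ‖x‖ → |φ x| ≤ M * ‖x‖ ^ a

/-- The space `C([0, ∞); BC_a)`. All the norms `‖·‖_{R,a}`, `R > 0`, are equivalent on `BC_a`, so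
continuity in time is expressed with `R = 1`. -/
def MemZ (n : ℕ) (a : ℝ) (μ : EuclideanSpace ℝ (Fin n) → ℝ → ℝ) : Prop :=
  (∀ t, 0 ≤ t → MemBC n a (fun x => μ x t)) ∧
  ∀ t₀, 0 ≤ t₀ →
    Tendsto (fun t => weightedNorm n 1 a (fun x => μ x t - μ x t₀)) (𝓝[Ici 0] t₀) (𝓝 0)

/-- The modified mild formulation `μ = u₀ + ∫₀ᵗ 𝓑 μ dτ + ∫₀ᵗ e^{(1-p)τ} 𝓑 [V μ^p] dτ` for all
`x ∈ ℝⁿ`, `t ≥ 0`, for a function `μ ≥ 0` in `C([0, ∞); BC_a)` with some `a ∈ ℝ`. That the last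
(space-time) integral converges is part of the notion. -/
structure IsGlobalModifiedMild (n : ℕ) (p : ℝ) (V : EuclideanSpace ℝ (Fin n) → ℝ → ℝ)
    (u₀ : EuclideanSpace ℝ (Fin n) → ℝ) (μ : EuclideanSpace ℝ (Fin n) → ℝ → ℝ) : Prop where
  nonneg : ∀ x t, 0 ≤ t → 0 ≤ μ x t
  mem : ∃ a : ℝ, MemZ n a μ
  source_integrable : ∀ x t, 0 ≤ t →
    IntegrableOn (fun z : ℝ × EuclideanSpace ℝ (Fin n) =>
      Real.exp ((1 - p) * z.1) * (besselKernel n (x - z.2) * (V z.2 z.1 * μ z.2 z.1 ^ p)))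
      (Ioc 0 t ×ˢ univ)
  eqn : ∀ x t, 0 ≤ t →
    μ x t = u₀ x + (∫ τ in (0 : ℝ)..t, besselPotential n (fun y => μ y τ) x) +
      ∫ τ in (0 : ℝ)..t,
        Real.exp ((1 - p) * τ) * besselPotential n (fun y => V y τ * μ y τ ^ p) x

/-- `u` is a (positive) global s-solution of `∂ₜu - Δ∂ₜu = Δu + V u^p`, `u(·,0) = u₀`: the function
`μ = eᵗ u` solves the modified mild formulation. -/
def IsGlobalSSolution (n : ℕ) (p : ℝ) (V : EuclideanSpace ℝ (Fin n) → ℝ → ℝ)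
    (u₀ : EuclideanSpace ℝ (Fin n) → ℝ) (u : EuclideanSpace ℝ (Fin n) → ℝ → ℝ) : Prop :=
  IsGlobalModifiedMild n p V u₀ (fun x t => Real.exp t * u x t)

/-- The set `J_n⁺ = {0} ∪ [(2 - n)₊, ∞)`. -/
def JPlus (n : ℕ) : Set ℝ := {0} ∪ Ici (max (2 - (n : ℝ)) 0)

/-- `V(x,t) ≳ Λ(t) |x|^σ` as `|x| → ∞`, for all `t > 0`. -/
def PotentialLowerBound (n : ℕ) (σ : ℝ) (Λ : ℝ → ℝ)
    (V : EuclideanSpace ℝ (Fin n) → ℝ → ℝ) : Prop :=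
  ∃ c > 0, ∃ R₀ : ℝ, ∀ x, R₀ ≤ ‖x‖ → ∀ t > 0, c * (Λ t * ‖x‖ ^ σ) ≤ V x t

/-- `Λ_*(t) = ∫₀ᵗ Λ(τ) dτ`. -/
def primitive (Λ : ℝ → ℝ) (t : ℝ) : ℝ := ∫ τ in (0 : ℝ)..t, Λ τ

/-- The `ε`-asymptotic bound condition defining the class `𝓔_ε`. -/
def EpsAsymptoticBound (ε : ℝ) (Λ : ℝ → ℝ) : Prop :=
  ∃ c > 0, ∃ t₀ > 0, ∀ t, ε⁻¹ * t₀ ≤ t → c * primitive Λ t ≤ primitive Λ (ε * t)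

/-- The function `Λ_{*,k,ν}`, the order of growth of `Λ_*` when `Λ` is of the order of
`t^k (log t)^ν`. -/
def logPowerPrimitive (k ν t : ℝ) : ℝ :=
  if k = -1 ∧ ν = -1 then Real.log (Real.log t)
  else if k = -1 then Real.log t ^ max (ν + 1) 0
  else (t * Real.log t ^ (ν / (k + 1))) ^ max (k + 1) 0

/-- The explicit lower grow-up rate when `Λ` is of the order of `t^k (log t)^ν`. -/
def logPowerGrowUp (p σ k ν t : ℝ) : ℝ :=
  if k = -1 ∧ ν = -1 then Real.log (Real.log t) ^ (1 / (1 - p)) * t ^ (σ / (2 * (1 - p)))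
  else if k = -1 then Real.log t ^ (max (ν + 1) 0 / (1 - p)) * t ^ (σ / (2 * (1 - p)))
  else t ^ ((σ + 2 * max (k + 1) 0) / (2 * (1 - p))) *
    Real.log t ^ ((if -1 < k then ν else 0) / (1 - p))

end

/-! Write `q = σ/(2(1-p))` and `μ = eᵗu`. Since `p < 1`, the ODE `m' = κΛm^p` forgets its initial
value: every positive solution exceeds `((1-p)κ(Λ_*(t) - Λ_*(t₁)))^{1/(1-p)}`. The proof transfers
this to the equation with the spatial profile `(K+|x|²)^q`, for which `|x|^σ W^p` is comparable with
`W`.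

Comparison. A subsolution `E` is brought under `μ` by iteration: if `βE ≤ μ`, the mild equation
improves `β` to `β + (1-β)η`, because `β ≤ β^p` on `[0,1]`
(`IsGlobalModifiedMild.le_of_subsolution`). No Lipschitz property of `m^p` is used.

Weights. Expanding `(s+|x-z|²)^q` and integrating against the radial kernel gives `𝓑W ≥ W(1 +
c/(s+|x|²))` for `W = (s+|x|²)^q` and large `s`, with `c > 0` when `q > 0` and `2q > 2-n`
(`exists_weight_le_besselPotential`). The membership `σ ∈ J_n⁺` with `σ > 0` yields this, as `2q =
σ/(1-p) > σ ≥ 2-n`; for `σ = 0` the weight is constant and `c = 0`.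

Universal profile. A nontrivial solution is at once above a multiple of `e^{-l|x|}`. Each use of the
source term moves the weight `(K+|x|²)^{q(1-θ)}e^{-lθ|x|}` from `θ` to `pθ`, so all `θ = p^k` are
reached by time 1, with constants depending on `k` and on the solution. The ODE bound on `[1,2]`
removes these constants, and `k → ∞` gives `μ(x,2) ≥ a(K+|x|²)^q` with a universal `a`. From time 2
the linear term contributes `eᵗ` and the source `Λ_*(t)^{1/(1-p)}` (`exists_static_lower_bound`).

Spreading. On `[εt, t]` the linear term alone turns `K+|x|²` into `K+γ(1-ε)t+|x|²`
(`exists_spreading`); the class `𝓔_ε` replaces `Λ_*(εt)` by `Λ_*(t)`. Part (2) checks this class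
with `ε = 1/2` and bounds `Λ_*` below by explicit antiderivatives. Norm bounds follow by looking at
the unit ball. -/

/-! ### Moments, mass and lower bound of the Bessel kernel. -/

/-- The value `d = 4` is the heat kernel, of mass 1; `d = 8` is the wider Gaussian that dominates
its polynomial multiples. -/
theorem integral_heat_gaussian (n : ℕ) {d s : ℝ} (hd : 0 < d) (hs : 0 < s) :
    ∫ z : EuclideanSpace ℝ (Fin n),
      (4 * Real.pi * s) ^ (-(n : ℝ) / 2) * Real.exp (-‖z‖ ^ 2 / (d * s)) =
      (d / 4) ^ ((n : ℝ) / 2) := by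
  rw [integral_const_mul]
  have h1 : ∀ z : EuclideanSpace ℝ (Fin n),
      Real.exp (-‖z‖ ^ 2 / (d * s)) = Real.exp (-(1 / (d * s)) * ‖z‖ ^ 2) := fun z => by
    congr 1; ring
  simp_rw [h1]
  rw [GaussianFourier.integral_rexp_neg_mul_sq_norm (by positivity)]
  simp only [finrank_euclideanSpace, Fintype.card_fin]
  rw [neg_div, Real.rpow_neg (by positivity), ← Real.inv_rpow (by positivity),
    ← Real.mul_rpow (by positivity) (by positivity)]
  congr 1
  have := Real.pi_pos
  field_simp

theorem integrable_heat_gaussian (n : ℕ) {d s : ℝ} (hd : 0 < d) (hs : 0 < s) :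
    Integrable fun z : EuclideanSpace ℝ (Fin n) =>
      (4 * Real.pi * s) ^ (-(n : ℝ) / 2) * Real.exp (-‖z‖ ^ 2 / (d * s)) := by
  by_contra h
  have h1 := integral_heat_gaussian n hd hs
  rw [integral_undef h] at h1
  have : 0 < (d / 4) ^ ((n : ℝ) / 2) := by positivity
  linarith

theorem integrableOn_exp_neg_mul_pow (k : ℕ) :
    IntegrableOn (fun s : ℝ => Real.exp (-s) * (1 + 8 * s) ^ k) (Ioi 0) := by
  have h0 := (exp_neg_integrableOn_Ioi 0 (b := 1 / 2) (by norm_num)).const_mul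
    (16 ^ k * k.factorial * Real.exp (1 / 16))
  refine Integrable.mono' h0 (by fun_prop) ?_
  filter_upwards [ae_restrict_mem measurableSet_Ioi] with s hs
  have hs : 0 < s := hs
  have h1 := Real.pow_div_factorial_le_exp (1 / 16 + s / 2) (by positivity) k
  rw [div_le_iff₀ (by positivity)] at h1
  rw [Real.norm_of_nonneg (by positivity)]
  have h2 : (1 + 8 * s) ^ k = 16 ^ k * (1 / 16 + s / 2) ^ k := by
    rw [← mul_pow]; congr 1; ring
  calc Real.exp (-s) * (1 + 8 * s) ^ k
      ≤ Real.exp (-s) * (16 ^ k * (Real.exp (1 / 16 + s / 2) * k.factorial)) := by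
        rw [h2]; gcongr
    _ = 16 ^ k * k.factorial * (Real.exp (1 / 16) * (Real.exp (-s) * Real.exp (s / 2))) := by
        rw [Real.exp_add]; ring
    _ = _ := by
        rw [← Real.exp_add (-s)]
        ring_nf

theorem integrable_heat_gaussian_prod (n k : ℕ) {d : ℝ} (hd : 0 < d) :
    Integrable (fun z : EuclideanSpace ℝ (Fin n) × ℝ => (Real.exp (-z.2) * (1 + 8 * z.2) ^ k) *
      ((4 * Real.pi * z.2) ^ (-(n : ℝ) / 2) * Real.exp (-‖z.1‖ ^ 2 / (d * z.2))))
      (volume.prod (volume.restrict (Ioi 0))) := by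
  rw [integrable_prod_iff' (by fun_prop)]
  constructor
  · filter_upwards [ae_restrict_mem measurableSet_Ioi] with s hs
    exact (integrable_heat_gaussian n hd hs).const_mul _
  · refine ((integrableOn_exp_neg_mul_pow k).mul_const ((d / 4) ^ ((n : ℝ) / 2))).congr ?_
    filter_upwards [ae_restrict_mem measurableSet_Ioi] with s hs
    have hs : 0 < s := hs
    have h1 : ∀ z : EuclideanSpace ℝ (Fin n), ‖(Real.exp (-s) * (1 + 8 * s) ^ k) *
      ((4 * Real.pi * s) ^ (-(n : ℝ) / 2) * Real.exp (-‖z‖ ^ 2 / (d * s)))‖ =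
      (Real.exp (-s) * (1 + 8 * s) ^ k) *
      ((4 * Real.pi * s) ^ (-(n : ℝ) / 2) * Real.exp (-‖z‖ ^ 2 / (d * s))) := fun z =>
        Real.norm_of_nonneg (by positivity)
    simp only [h1]
    rw [integral_const_mul, integral_heat_gaussian n hd hs]

/-- Half of the Gaussian exponent pays for the polynomial: with `y = r²/(8s)`, `1 + r² ≤
(1+8s)(1+y)` and `(1+y)^k ≤ k! e^{1+y}`. -/
theorem one_add_sq_pow_mul_exp_le (k : ℕ) {s r : ℝ} (hs : 0 < s) :
    (1 + r ^ 2) ^ k * Real.exp (-r ^ 2 / (4 * s)) ≤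
      (Real.exp 1 * k.factorial) * ((1 + 8 * s) ^ k * Real.exp (-r ^ 2 / (8 * s))) := by
  set y := r ^ 2 / (8 * s) with hy
  have hy0 : 0 ≤ y := by positivity
  have h1 : 1 + r ^ 2 ≤ (1 + 8 * s) * (1 + y) := by
    have : r ^ 2 = 8 * s * y := by rw [hy]; field_simp
    nlinarith
  have h2 := Real.pow_div_factorial_le_exp (1 + y) (by positivity) k
  rw [div_le_iff₀ (by positivity)] at h2
  have h3 : -r ^ 2 / (4 * s) = -y + -y := by rw [hy]; field_simp; ring
  have h4 : -r ^ 2 / (8 * s) = -y := by rw [hy]; ring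
  rw [h3, h4, Real.exp_add]
  calc (1 + r ^ 2) ^ k * (Real.exp (-y) * Real.exp (-y))
      ≤ ((1 + 8 * s) * (1 + y)) ^ k * (Real.exp (-y) * Real.exp (-y)) := by gcongr
    _ = (1 + 8 * s) ^ k * (1 + y) ^ k * (Real.exp (-y) * Real.exp (-y)) := by rw [mul_pow]
    _ ≤ (1 + 8 * s) ^ k * (Real.exp (1 + y) * k.factorial) * (Real.exp (-y) * Real.exp (-y)) := by
        gcongr
    _ = Real.exp 1 * k.factorial * ((1 + 8 * s) ^ k * Real.exp (-y)) *
        (Real.exp y * Real.exp (-y)) := by rw [Real.exp_add]; ring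
    _ = _ := by rw [← Real.exp_add]; simp

theorem integrable_besselIntegrand_prod (n k : ℕ) :
    Integrable (fun z : EuclideanSpace ℝ (Fin n) × ℝ => (1 + ‖z.1‖ ^ 2) ^ k *
      (Real.exp (-z.2) * ((4 * Real.pi * z.2) ^ (-(n : ℝ) / 2) *
        Real.exp (-‖z.1‖ ^ 2 / (4 * z.2)))))
      (volume.prod (volume.restrict (Ioi 0))) := by
  refine Integrable.mono' ((integrable_heat_gaussian_prod n k (d := 8) (by norm_num)).const_mul
    (Real.exp 1 * k.factorial)) (by fun_prop) ?_
  have hae : ∀ᵐ z ∂((volume : Measure (EuclideanSpace ℝ (Fin n))).prod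
      ((volume : Measure ℝ).restrict (Ioi 0))), 0 < z.2 :=
    Measure.quasiMeasurePreserving_snd.ae (ae_restrict_mem measurableSet_Ioi)
  filter_upwards [hae] with z hz
  rw [Real.norm_of_nonneg (by positivity)]
  have h := one_add_sq_pow_mul_exp_le k (r := ‖z.1‖) hz
  have h2 : 0 ≤ Real.exp (-z.2) * (4 * Real.pi * z.2) ^ (-(n : ℝ) / 2) := by positivity
  calc _ = Real.exp (-z.2) * (4 * Real.pi * z.2) ^ (-(n : ℝ) / 2) *
        ((1 + ‖z.1‖ ^ 2) ^ k * Real.exp (-‖z.1‖ ^ 2 / (4 * z.2))) := by ring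
    _ ≤ _ := mul_le_mul_of_nonneg_left h h2
    _ = _ := by ring

theorem besselKernel_nonneg (n : ℕ) (x : EuclideanSpace ℝ (Fin n)) : 0 ≤ besselKernel n x := by
  refine setIntegral_nonneg measurableSet_Ioi fun s hs => ?_
  have hs : 0 < s := hs
  positivity

theorem besselKernel_congr_norm {n : ℕ} {x y : EuclideanSpace ℝ (Fin n)} (h : ‖x‖ = ‖y‖) :
    besselKernel n x = besselKernel n y := by
  simp only [besselKernel, h]

theorem besselKernel_neg (n : ℕ) (x : EuclideanSpace ℝ (Fin n)) :
    besselKernel n (-x) = besselKernel n x := besselKernel_congr_norm (norm_neg x)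

theorem integrable_besselKernel_mul_pow (n k : ℕ) :
    Integrable fun z : EuclideanSpace ℝ (Fin n) => besselKernel n z * (1 + ‖z‖ ^ 2) ^ k := by
  refine (integrable_besselIntegrand_prod n k).integral_prod_left.congr (.of_forall fun z => ?_)
  simp only [besselKernel]
  rw [integral_const_mul, mul_comm]

theorem integrable_besselKernel (n : ℕ) : Integrable (besselKernel n) := by
  simpa using integrable_besselKernel_mul_pow n 0

theorem aestronglyMeasurable_besselKernel (n : ℕ) :
    AEStronglyMeasurable (besselKernel n) volume :=
  (integrable_besselKernel n).aestronglyMeasurable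

theorem integral_besselKernel (n : ℕ) : ∫ z, besselKernel n z = 1 := by
  have h := integrable_besselIntegrand_prod n 0
  simp only [pow_zero, one_mul] at h
  simp only [besselKernel]
  rw [integral_integral_swap (f := fun (z : EuclideanSpace ℝ (Fin n)) (s : ℝ) =>
    Real.exp (-s) * ((4 * Real.pi * s) ^ (-(n : ℝ) / 2) * Real.exp (-‖z‖ ^ 2 / (4 * s)))) h,
    ← integral_exp_neg_Ioi_zero]
  refine setIntegral_congr_fun measurableSet_Ioi fun s hs => ?_
  rw [integral_const_mul, integral_heat_gaussian n (by norm_num) hs]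
  simp

/-- The Bessel kernel is bounded below by an exponential. -/
theorem exists_exp_le_besselKernel (n : ℕ) : ∃ c > 0, ∃ l > 0,
    ∀ᵐ z : EuclideanSpace ℝ (Fin n), c * Real.exp (-l * ‖z‖) ≤ besselKernel n z := by
  have h := integrable_besselIntegrand_prod n 0
  simp only [pow_zero, one_mul] at h
  set b : ℝ := 4 * Real.pi * ((n : ℝ) / 2) with hb
  have hb0 : 0 ≤ b := by positivity
  refine ⟨Real.exp (-2 - 2 * b), Real.exp_pos _, 2 + b, by positivity, ?_⟩
  filter_upwards [h.prod_right_ae] with z hz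
  set r := ‖z‖ with hr
  have hr0 : 0 ≤ r := norm_nonneg z
  -- For `s` of order `|z|` both `e^{-s}` and the Gaussian factor `e^{-|z|²/(4s)}` decay only
  -- exponentially in `|z|`; a unit interval of such `s` suffices.
  have hsub : Ioc (r + 1) (r + 2) ⊆ Ioi (0 : ℝ) := fun s hs => by
    have := hs.1
    simp only [mem_Ioi]; linarith
  have hz' : IntegrableOn (fun s : ℝ => Real.exp (-s) * ((4 * Real.pi * s) ^ (-(n : ℝ) / 2) *
      Real.exp (-‖z‖ ^ 2 / (4 * s)))) (Ioi 0) := hz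
  have h1 : ∫ s in Ioc (r + 1) (r + 2), Real.exp (-s) * ((4 * Real.pi * s) ^ (-(n : ℝ) / 2) *
      Real.exp (-‖z‖ ^ 2 / (4 * s))) ≤ besselKernel n z := by
    refine setIntegral_mono_set hz' ?_ hsub.eventuallyLE
    filter_upwards [ae_restrict_mem measurableSet_Ioi] with s hs
    have hs : 0 < s := hs
    simp only [Pi.zero_apply]
    positivity
  refine le_trans ?_ h1
  have h2 : ∫ s in Ioc (r + 1) (r + 2), Real.exp (-2 - 2 * b) * Real.exp (-(2 + b) * r) =
      Real.exp (-2 - 2 * b) * Real.exp (-(2 + b) * r) := by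
    rw [setIntegral_const]
    simp only [measureReal_def, Real.volume_Ioc, smul_eq_mul]
    rw [show r + 2 - (r + 1) = 1 by ring]; simp
  rw [← h2]
  refine setIntegral_mono_on (integrableOn_const (by simp)) (hz'.mono_set hsub) measurableSet_Ioc fun s hs => ?_
  have hs0 : 0 < s := hsub hs
  -- The power prefactor is traded for an exponential through `log y ≤ y - 1`.
  have h3 : Real.exp (-b * s) ≤ (4 * Real.pi * s) ^ (-(n : ℝ) / 2) := by
    rw [Real.rpow_def_of_pos (by positivity)]
    apply Real.exp_le_exp.2
    have := Real.log_le_sub_one_of_pos (show 0 < 4 * Real.pi * s by positivity)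
    have hn : (0 : ℝ) ≤ (n : ℝ) / 2 := by positivity
    rw [hb]
    nlinarith
  have h4 : Real.exp (-r) ≤ Real.exp (-‖z‖ ^ 2 / (4 * s)) := by
    apply Real.exp_le_exp.2
    rw [← hr, neg_div, neg_le_neg_iff, div_le_iff₀ (by positivity)]
    nlinarith [hs.1]
  calc Real.exp (-2 - 2 * b) * Real.exp (-(2 + b) * r)
      = Real.exp (-(r + 2)) * (Real.exp (-b * (r + 2)) * Real.exp (-r)) := by
        rw [← Real.exp_add, ← Real.exp_add, ← Real.exp_add]; congr 1; ring
    _ ≤ Real.exp (-s) * (Real.exp (-b * s) * Real.exp (-r)) := by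
        have h5 : Real.exp (-(r + 2)) ≤ Real.exp (-s) := Real.exp_le_exp.2 (by linarith [hs.2])
        have h6 : Real.exp (-b * (r + 2)) ≤ Real.exp (-b * s) :=
          Real.exp_le_exp.2 (by nlinarith [hs.2])
        gcongr
    _ ≤ _ := by gcongr

theorem one_add_norm_sq_le {n : ℕ} (x y : EuclideanSpace ℝ (Fin n)) :
    1 + ‖y‖ ^ 2 ≤ 2 * (1 + ‖x‖ ^ 2) * (1 + ‖x - y‖ ^ 2) := by
  have h1 : ‖y‖ ≤ ‖x‖ + ‖x - y‖ := by
    have := norm_sub_le x (x - y)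
    simpa using this
  have h2 : ‖y‖ ^ 2 ≤ (‖x‖ + ‖x - y‖) ^ 2 := by gcongr
  nlinarith [sq_nonneg (‖x‖ - ‖x - y‖), mul_nonneg (sq_nonneg ‖x‖) (sq_nonneg ‖x - y‖)]

/-- The Bessel kernel has finite moments of all orders. -/
theorem integrable_besselKernel_sub_mul_rpow (n : ℕ) (a : ℝ) (x : EuclideanSpace ℝ (Fin n)) :
    Integrable fun y => besselKernel n (x - y) * (1 + ‖y‖ ^ 2) ^ a := by
  set k := ⌈a⌉₊
  have h0 := ((integrable_besselKernel_mul_pow n k).comp_sub_left x).const_mul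
    ((2 * (1 + ‖x‖ ^ 2)) ^ k)
  refine Integrable.mono' h0
    (((integrable_besselKernel n).comp_sub_left x).aestronglyMeasurable.mul
      (Measurable.aestronglyMeasurable (by fun_prop))) (.of_forall fun y => ?_)
  have hB := besselKernel_nonneg n (x - y)
  rw [Real.norm_of_nonneg (by positivity)]
  have h1 : (1 + ‖y‖ ^ 2) ^ a ≤ (1 + ‖y‖ ^ 2) ^ k := by
    rw [← Real.rpow_natCast (1 + ‖y‖ ^ 2) k]
    exact Real.rpow_le_rpow_of_exponent_le (le_add_of_nonneg_right (sq_nonneg _)) (Nat.le_ceil a)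
  have h2 : (1 + ‖y‖ ^ 2) ^ k ≤ (2 * (1 + ‖x‖ ^ 2) * (1 + ‖x - y‖ ^ 2)) ^ k := by
    gcongr; exact one_add_norm_sq_le x y
  calc besselKernel n (x - y) * (1 + ‖y‖ ^ 2) ^ a
      ≤ besselKernel n (x - y) * (2 * (1 + ‖x‖ ^ 2) * (1 + ‖x - y‖ ^ 2)) ^ k := by
        gcongr; exact h1.trans h2
    _ = _ := by rw [mul_pow]; ring

/-! ### Bessel potentials on the weighted spaces. -/

theorem MemBC.exists_bound {n : ℕ} {a : ℝ} {φ : EuclideanSpace ℝ (Fin n) → ℝ}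
    (h : MemBC n a φ) : ∃ M b : ℝ, ∀ x, |φ x| ≤ M * (1 + ‖x‖ ^ 2) ^ b := by
  obtain ⟨hc, M, r, hM⟩ := h
  obtain ⟨M', hM'⟩ := (isCompact_closedBall (0 : EuclideanSpace ℝ (Fin n))
    (max r 1)).exists_bound_of_continuousOn hc.continuousOn
  refine ⟨max |M| |M'|, |a|, fun x => ?_⟩
  have h1 : 1 ≤ (1 + ‖x‖ ^ 2) ^ |a| :=
    Real.one_le_rpow (le_add_of_nonneg_right (sq_nonneg _)) (abs_nonneg a)
  have hmax : 0 ≤ max |M| |M'| := le_max_of_le_left (abs_nonneg M)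
  rcases le_total ‖x‖ (max r 1) with hx | hx
  · have := hM' x (by simpa using hx)
    rw [Real.norm_eq_abs] at this
    calc |φ x| ≤ max |M| |M'| := this.trans ((le_abs_self M').trans (le_max_right _ _))
      _ ≤ _ := le_mul_of_one_le_right hmax h1
  · have hx1 : 1 ≤ ‖x‖ := (le_max_right _ _).trans hx
    have h2 : ‖x‖ ^ a ≤ (1 + ‖x‖ ^ 2) ^ |a| :=
      (Real.rpow_le_rpow_of_exponent_le hx1 (le_abs_self a)).trans
        (Real.rpow_le_rpow (by positivity) (by nlinarith) (abs_nonneg a))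
    calc |φ x| ≤ M * ‖x‖ ^ a := hM x ((le_max_left _ _).trans hx)
      _ ≤ max |M| |M'| * ‖x‖ ^ a := by
        gcongr; exact (le_abs_self M).trans (le_max_left _ _)
      _ ≤ _ := by gcongr

theorem MemBC.integrable {n : ℕ} {a : ℝ} {φ : EuclideanSpace ℝ (Fin n) → ℝ}
    (h : MemBC n a φ) (x : EuclideanSpace ℝ (Fin n)) :
    Integrable fun y => besselKernel n (x - y) * φ y := by
  obtain ⟨M, b, hM⟩ := h.exists_bound
  refine Integrable.mono' ((integrable_besselKernel_sub_mul_rpow n b x).const_mul M)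
    (((integrable_besselKernel n).comp_sub_left x).aestronglyMeasurable.mul
      h.1.aestronglyMeasurable) (.of_forall fun y => ?_)
  have hB := besselKernel_nonneg n (x - y)
  rw [norm_mul, Real.norm_of_nonneg hB, Real.norm_eq_abs]
  calc _ ≤ besselKernel n (x - y) * (M * (1 + ‖y‖ ^ 2) ^ b) := by gcongr; exact hM y
    _ = _ := by ring

/-- Integrating the weight `(1+|y|²)^{a/2}` against the kernel bounds the increment of the potential
at `x` by a constant times the weighted norm of the increment of `μ`. -/
theorem MemZ.continuousOn_besselPotential {n : ℕ} {a : ℝ}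
    {μ : EuclideanSpace ℝ (Fin n) → ℝ → ℝ} (h : MemZ n a μ) (x : EuclideanSpace ℝ (Fin n)) :
    ContinuousOn (fun t => besselPotential n (fun y => μ y t) x) (Ici 0) := by
  intro t₀ ht₀
  have hlim := h.2 t₀ ht₀
  set W : ℝ := ∫ y, besselKernel n (x - y) * (1 + ‖y‖ ^ 2) ^ (a / 2) with hW
  have hfin : ∀ᶠ t in 𝓝[Ici 0] t₀, weightedNorm n 1 a (fun x => μ x t - μ x t₀) < ⊤ :=
    hlim.eventually (gt_mem_nhds ENNReal.zero_lt_top)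
  have hreal := (ENNReal.tendsto_toReal ENNReal.zero_ne_top).comp hlim
  rw [ENNReal.toReal_zero] at hreal
  have hmul := hreal.mul_const W
  rw [zero_mul] at hmul
  rw [ContinuousWithinAt, tendsto_iff_norm_sub_tendsto_zero]
  refine squeeze_zero' (.of_forall fun _ => norm_nonneg _) ?_ hmul
  filter_upwards [hfin, self_mem_nhdsWithin] with t ht ht0
  have hi := (h.1 t ht0).integrable x
  have hi0 := (h.1 t₀ ht₀).integrable x
  simp only [besselPotential, Function.comp]
  rw [← integral_sub hi hi0, hW, ← integral_const_mul]
  refine norm_integral_le_of_norm_le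
    ((integrable_besselKernel_sub_mul_rpow n (a / 2) x).const_mul _) ?_
  have hae := ae_le_eLpNormEssSup (μ := (volume : Measure (EuclideanSpace ℝ (Fin n))))
    (f := fun x => ((1 : ℝ) ^ 2 + ‖x‖ ^ 2) ^ (-a / 2) * (μ x t - μ x t₀))
  rw [← eLpNorm_exponent_top] at hae
  change ∀ᵐ y, _ ≤ weightedNorm n 1 a (fun x => μ x t - μ x t₀) at hae
  filter_upwards [hae] with y hy
  have hB := besselKernel_nonneg n (x - y)
  have hy' := ENNReal.toReal_mono ht.ne hy
  rw [toReal_enorm, norm_mul, one_pow, neg_div, Real.rpow_neg (by positivity), norm_inv,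
    Real.norm_of_nonneg (show (0 : ℝ) ≤ (1 + ‖y‖ ^ 2) ^ (a / 2) by positivity),
    inv_mul_le_iff₀ (by positivity)] at hy'
  rw [← mul_sub, norm_mul, Real.norm_of_nonneg hB]
  calc _ ≤ _ := mul_le_mul_of_nonneg_left hy' hB
    _ = _ := by ring

/-! ### The mild formulation as an integral equation in time. -/

/-- The time derivative of a solution of the modified mild formulation. -/
noncomputable def mildRate (n : ℕ) (p : ℝ) (V μ : EuclideanSpace ℝ (Fin n) → ℝ → ℝ)
    (x : EuclideanSpace ℝ (Fin n)) (τ : ℝ) : ℝ :=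
  besselPotential n (fun y => μ y τ) x +
    Real.exp ((1 - p) * τ) * besselPotential n (fun y => V y τ * μ y τ ^ p) x

namespace IsGlobalModifiedMild

variable {n : ℕ} {p : ℝ} {V : EuclideanSpace ℝ (Fin n) → ℝ → ℝ}
  {u₀ : EuclideanSpace ℝ (Fin n) → ℝ} {μ : EuclideanSpace ℝ (Fin n) → ℝ → ℝ}

theorem integrable_linear (h : IsGlobalModifiedMild n p V u₀ μ) (x : EuclideanSpace ℝ (Fin n))
    {t : ℝ} (ht : 0 ≤ t) : Integrable fun y => besselKernel n (x - y) * μ y t := by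
  obtain ⟨a, ha⟩ := h.mem
  exact (ha.1 t ht).integrable x

theorem intervalIntegrable_linear (h : IsGlobalModifiedMild n p V u₀ μ)
    (x : EuclideanSpace ℝ (Fin n)) {t : ℝ} (ht : 0 ≤ t) :
    IntervalIntegrable (fun τ => besselPotential n (fun y => μ y τ) x) volume 0 t := by
  obtain ⟨a, ha⟩ := h.mem
  refine ContinuousOn.intervalIntegrable ((ha.continuousOn_besselPotential x).mono ?_)
  rw [uIcc_of_le ht]
  exact Icc_subset_Ici_self

theorem integrable_source_prod (h : IsGlobalModifiedMild n p V u₀ μ)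
    (x : EuclideanSpace ℝ (Fin n)) {t : ℝ} (ht : 0 ≤ t) :
    Integrable (fun z : ℝ × EuclideanSpace ℝ (Fin n) =>
      Real.exp ((1 - p) * z.1) * (besselKernel n (x - z.2) * (V z.2 z.1 * μ z.2 z.1 ^ p)))
      ((volume.restrict (Ioc 0 t)).prod volume) := by
  have := h.source_integrable x t ht
  rwa [IntegrableOn, Measure.volume_eq_prod, ← Measure.prod_restrict, Measure.restrict_univ] at this

theorem intervalIntegrable_source (h : IsGlobalModifiedMild n p V u₀ μ)
    (x : EuclideanSpace ℝ (Fin n)) {t : ℝ} (ht : 0 ≤ t) :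
    IntervalIntegrable (fun τ => Real.exp ((1 - p) * τ) *
      besselPotential n (fun y => V y τ * μ y τ ^ p) x) volume 0 t := by
  rw [intervalIntegrable_iff_integrableOn_Ioc_of_le ht]
  refine (h.integrable_source_prod x ht).integral_prod_left.congr (.of_forall fun τ => ?_)
  simp only [besselPotential]
  rw [integral_const_mul]

/-- Only the space-time integral of the source is known to converge, so Fubini gives spatial
integrability at almost every time; this is why later rate comparisons are almost everywhere in `τ`.
-/
theorem ae_integrable_source (h : IsGlobalModifiedMild n p V u₀ μ)
    (x : EuclideanSpace ℝ (Fin n)) (t : ℝ) :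
    ∀ᵐ τ, τ ∈ Ioc 0 t → Integrable fun y => besselKernel n (x - y) * (V y τ * μ y τ ^ p) := by
  rcases lt_or_ge t 0 with ht | ht
  · exact .of_forall fun τ hτ => absurd (hτ.1.le.trans hτ.2) (not_le.2 ht)
  rw [← ae_restrict_iff' measurableSet_Ioc]
  filter_upwards [(h.integrable_source_prod x ht).prod_right_ae] with τ hτ
  have := hτ.const_mul (Real.exp ((1 - p) * τ))⁻¹
  refine this.congr (.of_forall fun y => ?_)
  simp only
  rw [inv_mul_cancel_left₀ (Real.exp_pos _).ne']

theorem intervalIntegrable_mildRate (h : IsGlobalModifiedMild n p V u₀ μ)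
    (x : EuclideanSpace ℝ (Fin n)) {s t : ℝ} (hs : 0 ≤ s) (ht : 0 ≤ t) :
    IntervalIntegrable (mildRate n p V μ x) volume s t :=
  (((h.intervalIntegrable_linear x hs).add (h.intervalIntegrable_source x hs)).symm).trans
    ((h.intervalIntegrable_linear x ht).add (h.intervalIntegrable_source x ht))

theorem eq_add_integral_mildRate (h : IsGlobalModifiedMild n p V u₀ μ)
    (x : EuclideanSpace ℝ (Fin n)) {s t : ℝ} (hs : 0 ≤ s) (ht : 0 ≤ t) :
    μ x t = μ x s + ∫ τ in s..t, mildRate n p V μ x τ := by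
  have key : ∀ r, 0 ≤ r → μ x r = u₀ x + ∫ τ in (0 : ℝ)..r, mildRate n p V μ x τ := by
    intro r hr
    rw [h.eqn x r hr, add_assoc, ← intervalIntegral.integral_add
      (h.intervalIntegrable_linear x hr) (h.intervalIntegrable_source x hr)]
    rfl
  rw [key t ht, key s hs, add_assoc, intervalIntegral.integral_add_adjacent_intervals
    (h.intervalIntegrable_mildRate x le_rfl hs) (h.intervalIntegrable_mildRate x hs ht)]

theorem add_integral_le (h : IsGlobalModifiedMild n p V u₀ μ) (x : EuclideanSpace ℝ (Fin n))
    {s t : ℝ} (hs : 0 ≤ s) (hst : s ≤ t) {φ : ℝ → ℝ} (hφ : IntervalIntegrable φ volume s t)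
    (hle : ∀ᵐ τ, τ ∈ Ioc s t → φ τ ≤ mildRate n p V μ x τ) :
    μ x s + ∫ τ in s..t, φ τ ≤ μ x t := by
  rw [h.eq_add_integral_mildRate x hs (hs.trans hst)]
  gcongr
  refine intervalIntegral.integral_mono_ae_restrict hst hφ
    (h.intervalIntegrable_mildRate x hs (hs.trans hst)) ?_
  rw [← restrict_Ioc_eq_restrict_Icc]
  exact (ae_restrict_iff' measurableSet_Ioc).2 hle

end IsGlobalModifiedMild

/-! ### Power weights and the Bessel operator. -/

/-- Second-order Taylor bound valid down to `h = -1`. For `h ≤ -1/2` the left side is nonpositive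
since `8|h|³ ≥ 1`; on the other two ranges the derivative of the difference has a sign by
Bernoulli's inequality. -/
theorem rpow_one_add_ge_cubic {q h : ℝ} (hq0 : 0 < q) (hq1 : q < 1) (hh : -1 ≤ h) :
    1 + q * h - q * (1 - q) / 2 * h ^ 2 - 8 * |h| ^ 3 ≤ (1 + h) ^ q := by
  have hder : ∀ y : ℝ, -1 < y → HasDerivAt (fun y : ℝ => (1 + y) ^ q) (q * (1 + y) ^ (q - 1)) y := by
    intro y hy
    have := ((hasDerivAt_id y).const_add 1).rpow_const (p := q)
      (Or.inl (show (1 + id y) ≠ 0 by simp only [id]; linarith))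
    simpa using this
  have hbern : ∀ y : ℝ, -1 < y → (1 + y) ^ (1 - q) ≤ 1 + (1 - q) * y := fun y hy =>
    rpow_one_add_le_one_add_mul_self hy.le (by linarith) (by linarith)
  rcases le_total h (-1 / 2) with h1 | h1
  · have h0 : 0 ≤ (1 + h) ^ q := Real.rpow_nonneg (by linarith) q
    have h2 : (1 / 2 : ℝ) ^ 3 ≤ |h| ^ 3 := by
      gcongr; rw [abs_of_nonpos (by linarith)]; linarith
    have h3 : 0 ≤ q * (1 - q) / 2 * h ^ 2 :=
      mul_nonneg (div_nonneg (mul_nonneg hq0.le (by linarith)) (by norm_num)) (sq_nonneg h)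
    nlinarith
  rcases le_total h 0 with h2 | h2
  · have hD : ∀ y ∈ Icc (-1 / 2 : ℝ) 0, HasDerivAt
        (fun y : ℝ => (1 + y) ^ q - (1 + q * y - q * (1 - q) / 2 * y ^ 2 + 8 * y ^ 3))
        (q * (1 + y) ^ (q - 1) - (q - q * (1 - q) * y + 24 * y ^ 2)) y := by
      intro y hy
      refine (hder y (by linarith [hy.1])).sub ?_
      have := (((((hasDerivAt_id y).const_mul q).const_add 1).sub
        (((hasDerivAt_pow 2 y)).const_mul (q * (1 - q) / 2))).add
        ((hasDerivAt_pow 3 y).const_mul 8))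
      refine this.congr_deriv ?_
      norm_num; ring
    have hanti : AntitoneOn (fun y : ℝ => (1 + y) ^ q -
        (1 + q * y - q * (1 - q) / 2 * y ^ 2 + 8 * y ^ 3)) (Icc (-1 / 2 : ℝ) 0) := by
      refine antitoneOn_of_deriv_nonpos (convex_Icc _ _)
        (fun y hy => (hD y hy).continuousAt.continuousWithinAt)
        (fun y hy => (hD y (interior_subset hy)).differentiableAt.differentiableWithinAt) ?_
      intro y hy
      have hy := interior_subset hy
      rw [(hD y hy).deriv]
      have hy1 : 0 < 1 + y := by linarith [hy.1]
      -- Bernoulli for the exponent `1 - q`, applied to the base `(1+y)⁻¹`.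
      have h3 : (1 + y) ^ (q - 1) ≤ 1 + (1 - q) * ((1 + y)⁻¹ - 1) := by
        have := rpow_one_add_le_one_add_mul_self (s := (1 + y)⁻¹ - 1) (p := 1 - q)
          (by have := inv_pos.2 hy1; linarith) (by linarith) (by linarith)
        rw [add_sub_cancel, Real.inv_rpow hy1.le, ← Real.rpow_neg hy1.le, neg_sub] at this
        exact this
      have h4 : (1 + y)⁻¹ - 1 ≤ -y + 2 * y ^ 2 := by
        rw [sub_le_iff_le_add, inv_le_iff_one_le_mul₀ hy1]
        nlinarith [sq_nonneg y, hy.1, mul_nonneg (sq_nonneg y) (by linarith [hy.1] : 0 ≤ 1 + 2 * y)]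
      have h5 : (1 - q) * ((1 + y)⁻¹ - 1) ≤ (1 - q) * (-y + 2 * y ^ 2) :=
        mul_le_mul_of_nonneg_left h4 (by linarith)
      have h6 : q * (1 + y) ^ (q - 1) ≤ q * (1 + (1 - q) * (-y + 2 * y ^ 2)) := by
        gcongr; linarith
      have h7 : q * (1 - q) * y ^ 2 ≤ 1 * y ^ 2 := by gcongr; nlinarith
      nlinarith [sq_nonneg y]
    have := hanti ⟨h1, h2⟩ (right_mem_Icc.2 (by norm_num)) h2
    simp only [add_zero, Real.one_rpow, mul_zero] at this
    rw [abs_of_nonpos h2]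
    nlinarith
  · have hD : ∀ y ∈ Ici (0 : ℝ), HasDerivAt
        (fun y : ℝ => (1 + y) ^ q - (1 + q * y - q * (1 - q) / 2 * y ^ 2))
        (q * (1 + y) ^ (q - 1) - (q - q * (1 - q) * y)) y := by
      intro y hy
      have hy : 0 ≤ y := hy
      refine (hder y (by linarith)).sub ?_
      have := ((((hasDerivAt_id y).const_mul q).const_add 1).sub
        (((hasDerivAt_pow 2 y)).const_mul (q * (1 - q) / 2)))
      refine this.congr_deriv ?_
      norm_num; ring
    have hmono : MonotoneOn (fun y : ℝ => (1 + y) ^ q -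
        (1 + q * y - q * (1 - q) / 2 * y ^ 2)) (Ici (0 : ℝ)) := by
      refine monotoneOn_of_deriv_nonneg (convex_Ici _)
        (fun y hy => (hD y hy).continuousAt.continuousWithinAt)
        (fun y hy => (hD y (interior_subset hy)).differentiableAt.differentiableWithinAt) ?_
      intro y hy
      have hy := interior_subset hy
      rw [(hD y hy).deriv]
      have hy0 : 0 ≤ y := hy
      have hy1 : 0 < 1 + y := by linarith
      have h3 : 1 - (1 - q) * y ≤ (1 + y) ^ (q - 1) := by
        rw [← neg_sub 1 q, Real.rpow_neg hy1.le]
        refine le_trans ?_ (inv_anti₀ (Real.rpow_pos_of_pos hy1 _) (hbern y (by linarith)))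
        have h8 : 0 ≤ (1 - q) * y := mul_nonneg (by linarith) hy0
        rw [← one_div, le_div_iff₀ (by positivity)]
        nlinarith
      nlinarith
    have := hmono (mem_Ici.2 le_rfl) h2 h2
    simp only [add_zero, Real.one_rpow, mul_zero] at this
    have h9 : 0 ≤ |h| ^ 3 := by positivity
    nlinarith

theorem integrable_besselKernel_mul_of_le {n : ℕ} {f : EuclideanSpace ℝ (Fin n) → ℝ}
    (hf : Continuous f) {C : ℝ} {k : ℕ} (hle : ∀ z, |f z| ≤ C * (1 + ‖z‖ ^ 2) ^ k) :
    Integrable fun z => besselKernel n z * f z := by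
  refine Integrable.mono' ((integrable_besselKernel_mul_pow n k).const_mul C)
    ((aestronglyMeasurable_besselKernel n).mul hf.aestronglyMeasurable) (.of_forall fun z => ?_)
  have hB := besselKernel_nonneg n z
  rw [norm_mul, Real.norm_of_nonneg hB, Real.norm_eq_abs]
  calc _ ≤ besselKernel n z * (C * (1 + ‖z‖ ^ 2) ^ k) := mul_le_mul_of_nonneg_left (hle z) hB
    _ = _ := by ring

theorem integral_besselKernel_mul_odd {n : ℕ} {f : EuclideanSpace ℝ (Fin n) → ℝ}
    (hf : ∀ z, f (-z) = -f z) : ∫ z, besselKernel n z * f z = 0 := by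
  have h := integral_neg_eq_self (fun z => besselKernel n z * f z) volume
  simp only [besselKernel_neg, hf, mul_neg, integral_neg] at h
  linarith

theorem besselPotential_eq_integral_sub {n : ℕ} (f : EuclideanSpace ℝ (Fin n) → ℝ)
    (x : EuclideanSpace ℝ (Fin n)) :
    besselPotential n f x = ∫ z, besselKernel n z * f (x - z) := by
  rw [← integral_sub_left_eq_self _ volume x]
  simp [besselPotential]

/-- The reflection exchanging `u` and `v` preserves both Lebesgue measure and the radial kernel. -/
theorem integral_besselKernel_mul_inner_sq_congr {n : ℕ} {u v : EuclideanSpace ℝ (Fin n)}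
    (h : ‖u‖ = ‖v‖) :
    ∫ z, besselKernel n z * inner ℝ u z ^ 2 = ∫ z, besselKernel n z * inner ℝ v z ^ 2 := by
  set U := (ℝ ∙ (u - v))ᗮ.reflection
  have hU : U u = v := Submodule.reflection_sub h
  rw [← U.measurePreserving.integral_comp U.toHomeomorph.measurableEmbedding
    (fun z => besselKernel n z * inner ℝ v z ^ 2)]
  refine integral_congr_ae (.of_forall fun z => ?_)
  simp only
  rw [← hU, LinearIsometryEquiv.inner_map_map,
    besselKernel_congr_norm (LinearIsometryEquiv.norm_map U z)]

theorem integrable_besselKernel_mul_inner_sq {n : ℕ} (x : EuclideanSpace ℝ (Fin n)) :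
    Integrable fun z => besselKernel n z * inner ℝ x z ^ 2 := by
  refine integrable_besselKernel_mul_of_le (by fun_prop) (C := ‖x‖ ^ 2) (k := 1) fun z => ?_
  rw [abs_pow, pow_one]
  calc |inner ℝ x z| ^ 2 ≤ (‖x‖ * ‖z‖) ^ 2 := by gcongr; exact abs_real_inner_le_norm x z
    _ ≤ _ := by nlinarith [sq_nonneg ‖x‖]

theorem integrable_besselKernel_mul_norm_sq (n : ℕ) :
    Integrable fun z : EuclideanSpace ℝ (Fin n) => besselKernel n z * ‖z‖ ^ 2 := by
  refine integrable_besselKernel_mul_of_le (by fun_prop) (C := 1) (k := 1) fun z => ?_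
  rw [abs_of_nonneg (by positivity)]; linarith

/-- The second moments of the Bessel kernel are isotropic. -/
theorem integral_besselKernel_mul_inner_sq {n : ℕ} (x : EuclideanSpace ℝ (Fin n)) :
    n * ∫ z, besselKernel n z * inner ℝ x z ^ 2 =
      ‖x‖ ^ 2 * ∫ z : EuclideanSpace ℝ (Fin n), besselKernel n z * ‖z‖ ^ 2 := by
  -- Rotating `x` to `‖x‖eᵢ` for each `i` and summing over `i` turns the coordinate moments into the
  -- moment of `‖z‖²`.
  have h1 : ∀ i : Fin n, ∫ z, besselKernel n z * inner ℝ x z ^ 2 =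
      ‖x‖ ^ 2 * ∫ z : EuclideanSpace ℝ (Fin n), besselKernel n z * z i ^ 2 := by
    intro i
    rw [integral_besselKernel_mul_inner_sq_congr
      (v := ‖x‖ • EuclideanSpace.single i (1 : ℝ)) (by simp [norm_smul]), ← integral_const_mul]
    refine integral_congr_ae (.of_forall fun z => ?_)
    simp only [inner_smul_left, EuclideanSpace.inner_single_left]
    simp; ring
  have h2 : ∀ z : EuclideanSpace ℝ (Fin n), besselKernel n z * ‖z‖ ^ 2 =
      ∑ i, besselKernel n z * z i ^ 2 := fun z => by
    rw [EuclideanSpace.real_norm_sq_eq, Finset.mul_sum]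
  simp_rw [h2]
  rw [integral_finsetSum, Finset.mul_sum, ← Finset.sum_congr rfl (fun i _ => h1 i)]
  · simp
  · intro i _
    refine integrable_besselKernel_mul_of_le (by fun_prop) (C := 1) (k := 1) fun z => ?_
    rw [abs_of_nonneg (by positivity), EuclideanSpace.real_norm_sq_eq, pow_one, one_mul]
    have := Finset.single_le_sum (f := fun i => z i ^ 2) (fun i _ => sq_nonneg _)
      (Finset.mem_univ i)
    simp only at this
    linarith

theorem integral_besselKernel_mul_norm_sq_pos {n : ℕ} (hn : 1 ≤ n) :
    0 < ∫ z : EuclideanSpace ℝ (Fin n), besselKernel n z * ‖z‖ ^ 2 := by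
  obtain ⟨c, hc, l, hl, h⟩ := exists_exp_le_besselKernel n
  have : Nonempty (Fin n) := ⟨⟨0, hn⟩⟩
  have : Nontrivial (EuclideanSpace ℝ (Fin n)) := inferInstance
  refine (integral_pos_iff_support_of_nonneg_ae
    (.of_forall fun z => mul_nonneg (besselKernel_nonneg n z) (sq_nonneg _))
    (integrable_besselKernel_mul_norm_sq n)).2 ?_
  have hne : ∀ᵐ z : EuclideanSpace ℝ (Fin n), z ≠ 0 := by
    rw [ae_iff]; simp
  have : (univ : Set (EuclideanSpace ℝ (Fin n))) ≤ᵐ[volume]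
      (Function.support fun z : EuclideanSpace ℝ (Fin n) => besselKernel n z * ‖z‖ ^ 2) := by
    filter_upwards [h, hne] with z hz hz0 _
    have h1 : 0 < besselKernel n z := lt_of_lt_of_le (by positivity) hz
    have h2 : 0 < ‖z‖ := norm_pos_iff.2 hz0
    exact (by positivity : 0 < besselKernel n z * ‖z‖ ^ 2).ne'
  refine lt_of_lt_of_le ?_ (measure_mono_ae this)
  exact Measure.measure_univ_pos.2 (NeZero.ne _)

theorem add_norm_sq_rpow_le {n : ℕ} {s q : ℝ} (hs : 1 ≤ s) (hq : 0 ≤ q)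
    (y : EuclideanSpace ℝ (Fin n)) :
    (s + ‖y‖ ^ 2) ^ q ≤ s ^ q * (1 + ‖y‖ ^ 2) ^ q := by
  rw [← Real.mul_rpow (by positivity) (by positivity)]
  refine Real.rpow_le_rpow (by positivity) ?_ hq
  nlinarith [sq_nonneg ‖y‖]

theorem integrable_besselKernel_sub_mul_add_rpow {n : ℕ} {s q : ℝ} (hs : 1 ≤ s) (hq : 0 ≤ q)
    (x : EuclideanSpace ℝ (Fin n)) :
    Integrable fun y => besselKernel n (x - y) * (s + ‖y‖ ^ 2) ^ q := by
  refine Integrable.mono' ((integrable_besselKernel_sub_mul_rpow n q x).const_mul (s ^ q))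
    (((integrable_besselKernel n).comp_sub_left x).aestronglyMeasurable.mul
      (Measurable.aestronglyMeasurable (by fun_prop))) (.of_forall fun y => ?_)
  have hB := besselKernel_nonneg n (x - y)
  rw [Real.norm_of_nonneg (by positivity)]
  calc _ ≤ besselKernel n (x - y) * (s ^ q * (1 + ‖y‖ ^ 2) ^ q) :=
        mul_le_mul_of_nonneg_left (add_norm_sq_rpow_le hs hq y) hB
    _ = _ := by ring

theorem integral_le_besselPotential_weight {n : ℕ} {s q : ℝ} (hs : 1 ≤ s) (hq : 0 ≤ q)
    (x : EuclideanSpace ℝ (Fin n)) {f : EuclideanSpace ℝ (Fin n) → ℝ}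
    (hf : Integrable fun z => besselKernel n z * f z)
    (hle : ∀ z, f z ≤ (s + ‖x - z‖ ^ 2) ^ q) :
    ∫ z, besselKernel n z * f z ≤ besselPotential n (fun y => (s + ‖y‖ ^ 2) ^ q) x := by
  rw [besselPotential_eq_integral_sub]
  refine integral_mono hf ?_ fun z => mul_le_mul_of_nonneg_left (hle z) (besselKernel_nonneg n z)
  simpa using (integrable_besselKernel_sub_mul_add_rpow hs hq x).comp_sub_left x

theorem integrable_integral_add {α : Type*} [MeasurableSpace α] {m : Measure α} {f g : α → ℝ}
    {a b : ℝ} (hf : Integrable f m ∧ ∫ x, f x ∂m = a) (hg : Integrable g m ∧ ∫ x, g x ∂m = b) :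
    Integrable (fun x => f x + g x) m ∧ ∫ x, f x + g x ∂m = a + b :=
  ⟨hf.1.add hg.1, by rw [integral_add hf.1 hg.1, hf.2, hg.2]⟩

theorem integrable_integral_const_mul {α : Type*} [MeasurableSpace α] {m : Measure α} {f : α → ℝ}
    {a : ℝ} (c : ℝ) (hf : Integrable f m ∧ ∫ x, f x ∂m = a) :
    Integrable (fun x => c * f x) m ∧ ∫ x, c * f x ∂m = c * a :=
  ⟨hf.1.const_mul c, by rw [integral_const_mul, hf.2]⟩

theorem integrable_besselKernel_mul_inner {n : ℕ} (x : EuclideanSpace ℝ (Fin n)) :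
    Integrable fun z => besselKernel n z * inner ℝ x z := by
  refine integrable_besselKernel_mul_of_le (by fun_prop) (C := ‖x‖) (k := 1) fun z => ?_
  refine (abs_real_inner_le_norm x z).trans ?_
  rw [pow_one]
  gcongr
  nlinarith [sq_nonneg (‖z‖ - 1)]

theorem add_norm_sub_sq_rpow {n : ℕ} {s q : ℝ} (hs : 0 < s) (x z : EuclideanSpace ℝ (Fin n)) :
    -1 ≤ (‖z‖ ^ 2 - 2 * inner ℝ x z) / (s + ‖x‖ ^ 2) ∧
    (s + ‖x - z‖ ^ 2) ^ q =
      (s + ‖x‖ ^ 2) ^ q * (1 + (‖z‖ ^ 2 - 2 * inner ℝ x z) / (s + ‖x‖ ^ 2)) ^ q := by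
  have hρ : 0 < s + ‖x‖ ^ 2 := by positivity
  have h1 : (s + ‖x‖ ^ 2) * (1 + (‖z‖ ^ 2 - 2 * inner ℝ x z) / (s + ‖x‖ ^ 2)) =
      s + ‖x - z‖ ^ 2 := by
    rw [norm_sub_sq_real]; field_simp; ring
  have h2 : 0 ≤ 1 + (‖z‖ ^ 2 - 2 * inner ℝ x z) / (s + ‖x‖ ^ 2) := by
    by_contra h
    push Not at h
    have h3 : 0 ≤ s + ‖x - z‖ ^ 2 := by positivity
    nlinarith
  exact ⟨by linarith, by rw [← Real.mul_rpow hρ.le h2, h1]⟩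

/-- For `q ≥ 1` Bernoulli's inequality is enough: the term odd in `z` integrates to zero and
`q‖z‖²/ρ`, with `ρ = s+‖x‖²`, leaves `c = qM`. -/
theorem exists_weight_le_besselPotential_of_one_le {n : ℕ} (hn : 1 ≤ n) {q : ℝ} (hq : 1 ≤ q) :
    ∃ K ≥ (1 : ℝ), ∃ c > 0, ∀ s ≥ K, ∀ x : EuclideanSpace ℝ (Fin n),
      (s + ‖x‖ ^ 2) ^ q * (1 + c / (s + ‖x‖ ^ 2)) ≤
        besselPotential n (fun y => (s + ‖y‖ ^ 2) ^ q) x := by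
  set M := ∫ z : EuclideanSpace ℝ (Fin n), besselKernel n z * ‖z‖ ^ 2 with hM
  have hMpos : 0 < M := integral_besselKernel_mul_norm_sq_pos hn
  refine ⟨1, le_rfl, q * M, by positivity, fun s hs x => ?_⟩
  set ρ := s + ‖x‖ ^ 2 with hρ
  have hρ0 : 0 < ρ := by positivity
  have h0 : Integrable (besselKernel n) ∧ ∫ z, besselKernel n z = 1 :=
    ⟨integrable_besselKernel n, integral_besselKernel n⟩
  have h1 : Integrable (fun z : EuclideanSpace ℝ (Fin n) => besselKernel n z * ‖z‖ ^ 2) ∧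
    ∫ z : EuclideanSpace ℝ (Fin n), besselKernel n z * ‖z‖ ^ 2 = M :=
    ⟨integrable_besselKernel_mul_norm_sq n, rfl⟩
  have h2 : Integrable (fun z : EuclideanSpace ℝ (Fin n) => besselKernel n z * inner ℝ x z) ∧
    ∫ z : EuclideanSpace ℝ (Fin n), besselKernel n z * inner ℝ x z = 0 :=
    ⟨integrable_besselKernel_mul_inner x, integral_besselKernel_mul_odd (by simp)⟩
  obtain ⟨h3, h4⟩ := integrable_integral_const_mul (ρ ^ q) (integrable_integral_add
    (integrable_integral_add h0 (integrable_integral_const_mul (q / ρ) h1))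
    (integrable_integral_const_mul (-2 * q / ρ) h2))
  have h5 : ∀ z : EuclideanSpace ℝ (Fin n), ρ ^ q * (besselKernel n z + q / ρ *
      (besselKernel n z * ‖z‖ ^ 2) + -2 * q / ρ * (besselKernel n z * inner ℝ x z)) =
      besselKernel n z * (ρ ^ q * (1 + q * ((‖z‖ ^ 2 - 2 * inner ℝ x z) / ρ))) := fun z => by
    ring
  simp only [h5] at h3 h4
  refine le_trans (le_of_eq ?_) (integral_le_besselPotential_weight hs (by linarith) x h3 ?_)
  · rw [h4]; ring
  · intro z
    obtain ⟨h6, h7⟩ := add_norm_sub_sq_rpow (q := q) (by linarith : 0 < s) x z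
    rw [h7]
    gcongr
    exact one_add_mul_self_le_rpow_one_add h6 hq

/-- The relative increment is at most `(‖z‖²+2‖z‖)/√ρ` with `ρ = s+‖x‖²`, so the cubic remainder is
of order `ρ^{-3/2}`, below the order `1/ρ` of the expected gain. -/
theorem rpow_add_norm_sub_sq_ge_cubic {n : ℕ} {s q : ℝ} (hs : 1 ≤ s) (hq0 : 0 < q) (hq1 : q < 1)
    (x z : EuclideanSpace ℝ (Fin n)) :
    (s + ‖x‖ ^ 2) ^ q * (1 + q * ((‖z‖ ^ 2 - 2 * inner ℝ x z) / √(s + ‖x‖ ^ 2) ^ 2)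
      - q * (1 - q) / 2 * ((‖z‖ ^ 2 - 2 * inner ℝ x z) / √(s + ‖x‖ ^ 2) ^ 2) ^ 2
      - 8 * ((‖z‖ ^ 2 + 2 * ‖z‖) / √(s + ‖x‖ ^ 2)) ^ 3) ≤ (s + ‖x - z‖ ^ 2) ^ q := by
  obtain ⟨h10, h11⟩ := add_norm_sub_sq_rpow (q := q) (by linarith : 0 < s) x z
  have hρ0 : 0 < s + ‖x‖ ^ 2 := by positivity
  rw [h11, Real.sq_sqrt hρ0.le]
  refine mul_le_mul_of_nonneg_left ?_ (by positivity)
  refine le_trans ?_ (rpow_one_add_ge_cubic hq0 hq1 h10)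
  have h12 : |(‖z‖ ^ 2 - 2 * inner ℝ x z) / (s + ‖x‖ ^ 2)| ≤
      (‖z‖ ^ 2 + 2 * ‖z‖) / √(s + ‖x‖ ^ 2) := by
    have hr2 := Real.sq_sqrt hρ0.le
    have hxr : ‖x‖ ≤ √(s + ‖x‖ ^ 2) := Real.le_sqrt_of_sq_le (by linarith)
    have hr1 : 1 ≤ √(s + ‖x‖ ^ 2) := Real.le_sqrt_of_sq_le (by nlinarith [sq_nonneg ‖x‖])
    set r := √(s + ‖x‖ ^ 2)
    have hr0 : 0 < r := by linarith
    rw [← hr2, abs_div, abs_of_pos (by positivity : 0 < r ^ 2),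
      div_le_div_iff₀ (by positivity) hr0]
    have h13 : |‖z‖ ^ 2 - 2 * inner ℝ x z| ≤ ‖z‖ ^ 2 + 2 * (‖x‖ * ‖z‖) := by
      have := abs_real_inner_le_norm x z
      rw [abs_le] at this ⊢
      constructor <;> nlinarith [sq_nonneg ‖z‖]
    have h14 : ‖z‖ ^ 2 + 2 * (‖x‖ * ‖z‖) ≤ (‖z‖ ^ 2 + 2 * ‖z‖) * r := by
      have := mul_le_mul_of_nonneg_right hxr (norm_nonneg z)
      nlinarith [sq_nonneg ‖z‖]
    calc _ ≤ (‖z‖ ^ 2 + 2 * ‖z‖) * r * r := by gcongr; exact h13.trans h14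
      _ = _ := by ring
  gcongr

/-- For `q < 1` concavity costs a second-order term; isotropy evaluates it exactly, and what remains
at order `1/ρ` is positive precisely because `2q + n - 2 > 0`, as for the Laplacian of `|x|^{2q}`.
-/
theorem exists_weight_le_besselPotential_of_lt_one {n : ℕ} (hn : 1 ≤ n) {q : ℝ} (hq0 : 0 < q)
    (hq1 : q < 1) (hqn : 2 - (n : ℝ) < 2 * q) :
    ∃ K ≥ (1 : ℝ), ∃ c > 0, ∀ s ≥ K, ∀ x : EuclideanSpace ℝ (Fin n),
      (s + ‖x‖ ^ 2) ^ q * (1 + c / (s + ‖x‖ ^ 2)) ≤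
        besselPotential n (fun y => (s + ‖y‖ ^ 2) ^ q) x := by
  set M := ∫ z : EuclideanSpace ℝ (Fin n), besselKernel n z * ‖z‖ ^ 2 with hM
  set M4 := ∫ z : EuclideanSpace ℝ (Fin n), besselKernel n z * ‖z‖ ^ 4 with hM4
  set M3 := ∫ z : EuclideanSpace ℝ (Fin n), besselKernel n z * (‖z‖ ^ 2 + 2 * ‖z‖) ^ 3 with hM3
  have hMpos : 0 < M := integral_besselKernel_mul_norm_sq_pos hn
  have hM4' : 0 ≤ M4 :=
    integral_nonneg fun z => mul_nonneg (besselKernel_nonneg n z) (by positivity)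
  have hM3' : 0 ≤ M3 :=
    integral_nonneg fun z => mul_nonneg (besselKernel_nonneg n z) (by positivity)
  have hn0 : (0 : ℝ) < n := by exact_mod_cast hn
  set κ := q * (1 - q) / 2 with hκ
  have hκ0 : 0 ≤ κ := div_nonneg (mul_nonneg hq0.le (by linarith)) (by norm_num)
  -- The coefficient of `1/ρ` in the worst case, where `‖x‖²` is replaced by `ρ`; it equals
  -- `q(M/n)(n-2+2q)`.
  set d := q * M - 4 * κ * (M / n) with hd
  have hd0 : 0 < d := by
    have : d = q * (M / n) * (n - 2 * (1 - q)) := by rw [hd, hκ]; field_simp; ring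
    rw [this]
    have : 0 < n - 2 * (1 - q) := by linarith
    positivity
  -- For `√ρ ≥ r₀` the terms with `M4` and `M3` use up at most half of `d`; hence `K = r₀²` and `c =
  -- d/2`.
  set r₀ := max 1 (2 * (κ * M4 + 8 * M3) / d) with hr₀
  have hr₀1 : 1 ≤ r₀ := le_max_left _ _
  refine ⟨r₀ ^ 2, one_le_pow₀ hr₀1, d / 2, by positivity, fun s hs x => ?_⟩
  have hs1 : 1 ≤ s := (one_le_pow₀ hr₀1).trans hs
  set ρ := s + ‖x‖ ^ 2 with hρ
  have hρ0 : 0 < ρ := by positivity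
  set r := √ρ with hr
  have hr2 : r ^ 2 = ρ := Real.sq_sqrt hρ0.le
  have hrr₀ : r₀ ≤ r := Real.le_sqrt_of_sq_le (by nlinarith [sq_nonneg ‖x‖])
  have hr1 : 1 ≤ r := hr₀1.trans hrr₀
  have hxr : ‖x‖ ≤ r := Real.le_sqrt_of_sq_le (by linarith)
  have h0 : Integrable (besselKernel n) ∧ ∫ z, besselKernel n z = 1 :=
    ⟨integrable_besselKernel n, integral_besselKernel n⟩
  have h1 : Integrable (fun z : EuclideanSpace ℝ (Fin n) => besselKernel n z * ‖z‖ ^ 2) ∧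
    ∫ z : EuclideanSpace ℝ (Fin n), besselKernel n z * ‖z‖ ^ 2 = M :=
    ⟨integrable_besselKernel_mul_norm_sq n, rfl⟩
  have h2 : Integrable (fun z : EuclideanSpace ℝ (Fin n) => besselKernel n z * inner ℝ x z) ∧
    ∫ z : EuclideanSpace ℝ (Fin n), besselKernel n z * inner ℝ x z = 0 :=
    ⟨integrable_besselKernel_mul_inner x, integral_besselKernel_mul_odd (by simp)⟩
  have h3 : Integrable (fun z : EuclideanSpace ℝ (Fin n) => besselKernel n z * ‖z‖ ^ 4) ∧
    ∫ z : EuclideanSpace ℝ (Fin n), besselKernel n z * ‖z‖ ^ 4 = M4 := by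
    refine ⟨integrable_besselKernel_mul_of_le (by fun_prop) (C := 1) (k := 2) fun z => ?_, rfl⟩
    rw [abs_of_nonneg (by positivity)]; nlinarith [sq_nonneg ‖z‖]
  have h4 : Integrable (fun z : EuclideanSpace ℝ (Fin n) =>
      besselKernel n z * (inner ℝ x z * ‖z‖ ^ 2)) ∧
    ∫ z : EuclideanSpace ℝ (Fin n), besselKernel n z * (inner ℝ x z * ‖z‖ ^ 2) = 0 := by
    refine ⟨integrable_besselKernel_mul_of_le (by fun_prop) (C := ‖x‖) (k := 2) fun z => ?_,
      integral_besselKernel_mul_odd (by simp)⟩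
    rw [abs_mul, abs_of_nonneg (sq_nonneg ‖z‖)]
    calc _ ≤ (‖x‖ * ‖z‖) * ‖z‖ ^ 2 := by gcongr; exact abs_real_inner_le_norm x z
      _ = ‖x‖ * (‖z‖ * ‖z‖ ^ 2) := by ring
      _ ≤ _ := by
        gcongr
        nlinarith [mul_nonneg (sq_nonneg ‖z‖) (sq_nonneg (‖z‖ - 1)), norm_nonneg z]
  have h5 : Integrable (fun z : EuclideanSpace ℝ (Fin n) =>
      besselKernel n z * inner ℝ x z ^ 2) ∧
    ∫ z : EuclideanSpace ℝ (Fin n), besselKernel n z * inner ℝ x z ^ 2 = ‖x‖ ^ 2 * M / n :=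
    ⟨integrable_besselKernel_mul_inner_sq x, by
      rw [eq_div_iff hn0.ne', mul_comm]; exact integral_besselKernel_mul_inner_sq x⟩
  have h6 : Integrable (fun z : EuclideanSpace ℝ (Fin n) =>
      besselKernel n z * (‖z‖ ^ 2 + 2 * ‖z‖) ^ 3) ∧
    ∫ z : EuclideanSpace ℝ (Fin n), besselKernel n z * (‖z‖ ^ 2 + 2 * ‖z‖) ^ 3 = M3 := by
    refine ⟨integrable_besselKernel_mul_of_le (by fun_prop) (C := 8) (k := 3) fun z => ?_, rfl⟩
    rw [abs_of_nonneg (by positivity)]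
    calc (‖z‖ ^ 2 + 2 * ‖z‖) ^ 3 ≤ (2 * (1 + ‖z‖ ^ 2)) ^ 3 := by
          gcongr; nlinarith [sq_nonneg (‖z‖ - 1)]
      _ = _ := by ring
  obtain ⟨h7, h8⟩ := integrable_integral_const_mul (ρ ^ q) (integrable_integral_add
    (integrable_integral_add (integrable_integral_add (integrable_integral_add
    (integrable_integral_add (integrable_integral_add h0
      (integrable_integral_const_mul (q / r ^ 2) h1))
      (integrable_integral_const_mul (-2 * q / r ^ 2) h2))
      (integrable_integral_const_mul (-κ / r ^ 4) h3))
      (integrable_integral_const_mul (4 * κ / r ^ 4) h4))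
      (integrable_integral_const_mul (-4 * κ / r ^ 4) h5))
      (integrable_integral_const_mul (-8 / r ^ 3) h6))
  have h9 : ∀ z : EuclideanSpace ℝ (Fin n), ρ ^ q * (besselKernel n z + q / r ^ 2 *
      (besselKernel n z * ‖z‖ ^ 2) + -2 * q / r ^ 2 * (besselKernel n z * inner ℝ x z) +
      -κ / r ^ 4 * (besselKernel n z * ‖z‖ ^ 4) +
      4 * κ / r ^ 4 * (besselKernel n z * (inner ℝ x z * ‖z‖ ^ 2)) +
      -4 * κ / r ^ 4 * (besselKernel n z * inner ℝ x z ^ 2) +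
      -8 / r ^ 3 * (besselKernel n z * (‖z‖ ^ 2 + 2 * ‖z‖) ^ 3)) =
      besselKernel n z * (ρ ^ q * (1 + q * ((‖z‖ ^ 2 - 2 * inner ℝ x z) / r ^ 2)
        - κ * ((‖z‖ ^ 2 - 2 * inner ℝ x z) / r ^ 2) ^ 2
        - 8 * ((‖z‖ ^ 2 + 2 * ‖z‖) / r) ^ 3)) := fun z => by
    field_simp
    ring
  simp only [h9] at h7 h8
  refine le_trans ?_ (integral_le_besselPotential_weight hs1 hq0.le x h7 ?_)
  · rw [h8, ← hr2]
    refine mul_le_mul_of_nonneg_left ?_ (by positivity)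
    have hr0 : 0 < r := by linarith
    have h10 : 2 * (κ * M4 + 8 * M3) ≤ d * r := by
      have := (le_max_right 1 (2 * (κ * M4 + 8 * M3) / d)).trans hrr₀
      rwa [div_le_iff₀' hd0] at this
    have h11 : ‖x‖ ^ 2 ≤ r ^ 2 := by gcongr
    have h12 : κ * M4 ≤ κ * M4 * r := le_mul_of_one_le_right (by positivity) hr1
    have h13 : 4 * κ * (‖x‖ ^ 2 * M / n) ≤ 4 * κ * (r ^ 2 * M / n) := by gcongr
    have e1 : 1 + q / r ^ 2 * M + -2 * q / r ^ 2 * 0 + -κ / r ^ 4 * M4 + 4 * κ / r ^ 4 * 0 +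
        -4 * κ / r ^ 4 * (‖x‖ ^ 2 * M / n) + -8 / r ^ 3 * M3 =
        1 + (q * M * r ^ 2 - κ * M4 - 4 * κ * (‖x‖ ^ 2 * M / n) - 8 * M3 * r) / r ^ 4 := by
      field_simp
      ring
    have e2 : 1 + d / 2 / r ^ 2 = 1 + (d / 2 * r ^ 2) / r ^ 4 := by field_simp
    rw [e1, e2]
    have e3 : q * M * r ^ 2 - 4 * κ * (r ^ 2 * M / n) = d * r ^ 2 := by rw [hd]; ring
    have h14 := mul_le_mul_of_nonneg_right h10 hr0.le
    have h15 : d / 2 * r ^ 2 ≤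
        q * M * r ^ 2 - κ * M4 - 4 * κ * (‖x‖ ^ 2 * M / n) - 8 * M3 * r := by linarith
    linarith [div_le_div_of_nonneg_right h15 (by positivity : 0 ≤ r ^ 4)]
  · exact rpow_add_norm_sub_sq_ge_cubic hs1 hq0 hq1 x

/-- The weights `(s + |x|²)^q` are uniformly subharmonic for the Bessel operator. -/
theorem exists_weight_le_besselPotential {n : ℕ} (hn : 1 ≤ n) {q : ℝ}
    (hq : q = 0 ∨ 0 < q ∧ 2 - (n : ℝ) < 2 * q) :
    ∃ K ≥ (1 : ℝ), ∃ c ≥ 0, (0 < q → 0 < c) ∧ ∀ s ≥ K, ∀ x : EuclideanSpace ℝ (Fin n),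
      (s + ‖x‖ ^ 2) ^ q * (1 + c / (s + ‖x‖ ^ 2)) ≤
        besselPotential n (fun y => (s + ‖y‖ ^ 2) ^ q) x := by
  rcases hq with rfl | ⟨hq0, hqn⟩
  · refine ⟨1, le_rfl, 0, le_rfl, fun h => absurd h (lt_irrefl _), fun s _ x => ?_⟩
    rw [besselPotential_eq_integral_sub]
    simp [integral_besselKernel]
  · rcases lt_or_ge q 1 with h1 | h1
    · obtain ⟨K, hK, c, hc, h⟩ := exists_weight_le_besselPotential_of_lt_one hn hq0 h1 hqn
      exact ⟨K, hK, c, hc.le, fun _ => hc, h⟩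
    · obtain ⟨K, hK, c, hc, h⟩ := exists_weight_le_besselPotential_of_one_le hn h1
      exact ⟨K, hK, c, hc.le, fun _ => hc, h⟩

/-! ### Monotonicity and the comparison principle. -/

theorem besselPotential_nonneg {n : ℕ} {f : EuclideanSpace ℝ (Fin n) → ℝ} (hf : ∀ y, 0 ≤ f y)
    (x : EuclideanSpace ℝ (Fin n)) : 0 ≤ besselPotential n f x :=
  integral_nonneg fun y => mul_nonneg (besselKernel_nonneg n _) (hf y)

theorem besselPotential_mono {n : ℕ} {f g : EuclideanSpace ℝ (Fin n) → ℝ} (hf : ∀ y, 0 ≤ f y)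
    (hfg : ∀ y, f y ≤ g y) {x : EuclideanSpace ℝ (Fin n)}
    (hg : Integrable fun y => besselKernel n (x - y) * g y) :
    besselPotential n f x ≤ besselPotential n g x :=
  integral_mono_of_nonneg
    (.of_forall fun y => mul_nonneg (besselKernel_nonneg n _) (hf y)) hg
    (.of_forall fun y => mul_le_mul_of_nonneg_left (hfg y) (besselKernel_nonneg n _))

theorem besselPotential_const_mul {n : ℕ} (c : ℝ) (f : EuclideanSpace ℝ (Fin n) → ℝ)
    (x : EuclideanSpace ℝ (Fin n)) :
    besselPotential n (fun y => c * f y) x = c * besselPotential n f x := by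
  simp only [besselPotential]
  rw [← integral_const_mul]
  congr 1; ext y; ring

/-- Comparison principle: a subsolution `E` of a rate that is homogeneous of degree at most one
stays below a solution. -/
theorem IsGlobalModifiedMild.le_of_subsolution {n : ℕ} {p : ℝ}
    {V : EuclideanSpace ℝ (Fin n) → ℝ → ℝ} {u₀ : EuclideanSpace ℝ (Fin n) → ℝ}
    {μ : EuclideanSpace ℝ (Fin n) → ℝ → ℝ} (h : IsGlobalModifiedMild n p V u₀ μ)
    {E D : EuclideanSpace ℝ (Fin n) → ℝ → ℝ} {t₁ T η : ℝ} (ht₁ : 0 ≤ t₁)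
    (hη0 : 0 < η) (hη1 : η ≤ 1)
    (hE : ∀ x, ∀ t ∈ Icc t₁ T, HasDerivAt (E x) (D x t) t)
    (hD : ∀ x, ContinuousOn (D x) (Icc t₁ T))
    (hEη : ∀ x, ∀ t ∈ Icc t₁ T, η * E x t ≤ E x t₁)
    (h0 : ∀ x, E x t₁ ≤ μ x t₁)
    (hsub : ∀ β ∈ Icc (0 : ℝ) 1, (∀ x, ∀ t ∈ Icc t₁ T, β * E x t ≤ μ x t) →
      ∀ x, ∀ᵐ τ, τ ∈ Ioc t₁ T → β * D x τ ≤ mildRate n p V μ x τ) :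
    ∀ x, ∀ t ∈ Icc t₁ T, E x t ≤ μ x t := by
  have hpow : ∀ k : ℕ, 0 ≤ (1 - η) ^ k ∧ (1 - η) ^ k ≤ 1 := fun k =>
    ⟨pow_nonneg (by linarith) k, pow_le_one₀ (by linarith) (by linarith)⟩
  -- If `βE ≤ μ`, integrating the rate gives `μ(t) ≥ E(t₁) + β(E(t) - E(t₁)) = βE(t) + (1-β)E(t₁)`,
  -- which is at least `(β + (1-β)η)E(t)`. Starting from `β = 0`, the factors are `1 - (1-η)^k → 1`.
  have key : ∀ k : ℕ, ∀ x, ∀ t ∈ Icc t₁ T, (1 - (1 - η) ^ k) * E x t ≤ μ x t := by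
    intro k
    induction k with
    | zero =>
      intro x t ht
      simpa using h.nonneg x t (ht₁.trans ht.1)
    | succ k ih =>
      intro x t ht
      obtain ⟨hb0, hb1⟩ := hpow k
      set β := 1 - (1 - η) ^ k with hβ
      have hle := hsub β ⟨by linarith, by linarith⟩ ih x
      have hsubset : uIcc t₁ t ⊆ Icc t₁ T := by
        rw [uIcc_of_le ht.1]; exact Icc_subset_Icc_right ht.2
      have hDi : IntervalIntegrable (D x) volume t₁ t :=
        ((hD x).mono hsubset).intervalIntegrable
      have h1 := h.add_integral_le x ht₁ ht.1 (hDi.const_mul β) (by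
        filter_upwards [hle] with τ hτ hτ' using hτ ⟨hτ'.1, hτ'.2.trans ht.2⟩)
      rw [intervalIntegral.integral_const_mul, intervalIntegral.integral_eq_sub_of_hasDerivAt
        (fun τ hτ => hE x τ (hsubset hτ)) hDi] at h1
      have h2 := mul_le_mul_of_nonneg_left (hEη x t ht) hb0
      have h3 := h0 x
      have h4 : 1 - (1 - η) ^ (k + 1) = β + (1 - η) ^ k * η := by rw [hβ, pow_succ]; ring
      have h5 : (1 - η) ^ k = 1 - β := by rw [hβ]; ring
      rw [h4]
      rw [h5] at h2 ⊢
      nlinarith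
  intro x t ht
  have hlim : Tendsto (fun k : ℕ => (1 - (1 - η) ^ k) * E x t) atTop (𝓝 ((1 - 0) * E x t)) :=
    ((tendsto_pow_atTop_nhds_zero_of_lt_one (by linarith) (by linarith)).const_sub 1).mul_const _
  rw [sub_zero, one_mul] at hlim
  exact le_of_tendsto' hlim fun k => key k x t ht

/-! ### Lower bounds for the source term. -/

theorem exists_unit_vector_add {n : ℕ} (hn : 1 ≤ n) (x : EuclideanSpace ℝ (Fin n)) :
    ∃ e : EuclideanSpace ℝ (Fin n), ‖e‖ = 1 ∧ ∀ r : ℝ, 0 ≤ r → ‖x + r • e‖ = ‖x‖ + r := by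
  by_cases hx : x = 0
  · refine ⟨EuclideanSpace.single ⟨0, hn⟩ 1, by simp, fun r hr => ?_⟩
    simp [hx, norm_smul, abs_of_nonneg hr]
  · have hx' : 0 < ‖x‖ := norm_pos_iff.2 hx
    refine ⟨‖x‖⁻¹ • x, by simp [norm_smul, hx'.ne'], fun r hr => ?_⟩
    have : x + r • ‖x‖⁻¹ • x = (1 + r * ‖x‖⁻¹) • x := by rw [add_smul, one_smul, smul_smul]
    rw [this, norm_smul, Real.norm_of_nonneg (by positivity)]
    field_simp

/-- Lower bound for the Bessel potential in terms of the values on an adjacent outer annulus. -/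
theorem exists_annulus_le_besselPotential {n : ℕ} (hn : 1 ≤ n) (R₀ : ℝ) :
    ∃ r > 0, ∃ κ > 0, ∀ (x : EuclideanSpace ℝ (Fin n)) (f : EuclideanSpace ℝ (Fin n) → ℝ) (m : ℝ),
      (∀ y, 0 ≤ f y) → Integrable (fun y => besselKernel n (x - y) * f y) → 0 ≤ m →
      (∀ y, R₀ ≤ ‖y‖ → ‖x‖ + 1 ≤ ‖y‖ → ‖y‖ ≤ ‖x‖ + r → m ≤ f y) →
      κ * m ≤ besselPotential n f x := by
  obtain ⟨c, hc, l, hl, hB⟩ := exists_exp_le_besselKernel n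
  set R := max R₀ 1 with hR
  have hR1 : 1 ≤ R := le_max_right _ _
  have hR0 : R₀ ≤ R := le_max_left _ _
  have hRpos : 0 < R := by linarith
  set v := (volume : Measure (EuclideanSpace ℝ (Fin n))).real (Metric.ball 0 R) with hv
  have hvpos : 0 < v :=
    ENNReal.toReal_pos (Metric.measure_ball_pos _ _ hRpos).ne' measure_ball_lt_top.ne
  refine ⟨3 * R, by positivity, v * (c * Real.exp (-l * (3 * R))), by positivity,
    fun x f m hf hint hm hle => ?_⟩
  obtain ⟨e, he, hadd⟩ := exists_unit_vector_add hn x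
  -- Shifted radially outward by `2R`, this ball lies where `‖y‖ ≥ ‖x‖ + R ≥ R₀`, so the potential
  -- bound applies even for small `x`, and within distance `3R` of `x`, so the kernel is bounded
  -- below uniformly in `x`.
  set Q := Metric.ball (x + (2 * R) • e) R with hQ
  have hvQ : (volume : Measure (EuclideanSpace ℝ (Fin n))).real Q = v := by
    rw [hv, hQ, measureReal_def, measureReal_def, Measure.addHaar_ball_center]
  have hBx : ∀ᵐ y : EuclideanSpace ℝ (Fin n),
      c * Real.exp (-l * ‖x - y‖) ≤ besselKernel n (x - y) :=
    (Measure.measurePreserving_sub_left volume x).quasiMeasurePreserving.ae hB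
  have h1 : ∫ y in Q, besselKernel n (x - y) * f y ≤ besselPotential n f x :=
    setIntegral_le_integral hint
      (.of_forall fun y => mul_nonneg (besselKernel_nonneg n _) (hf y))
  refine le_trans ?_ h1
  have h2 : ∫ y in Q, c * Real.exp (-l * (3 * R)) * m =
      v * (c * Real.exp (-l * (3 * R))) * m := by
    rw [setIntegral_const, hvQ, smul_eq_mul, mul_assoc, mul_assoc, mul_assoc]
  rw [← h2]
  refine setIntegral_mono_on_ae (integrableOn_const measure_ball_lt_top.ne) hint.integrableOn
    measurableSet_ball ?_
  filter_upwards [hBx] with y hy hyQ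
  rw [hQ, Metric.mem_ball, dist_eq_norm] at hyQ
  have h3 := hadd (2 * R) (by positivity)
  have h4 : ‖y‖ ≤ ‖x‖ + 2 * R + ‖y - (x + (2 * R) • e)‖ := by
    rw [← h3]
    calc ‖y‖ = ‖(x + (2 * R) • e) + (y - (x + (2 * R) • e))‖ := by congr 1; abel
      _ ≤ _ := norm_add_le _ _
  have h5 : ‖x‖ + 2 * R - ‖y - (x + (2 * R) • e)‖ ≤ ‖y‖ := by
    rw [← h3]
    calc _ ≤ ‖(x + (2 * R) • e) + (y - (x + (2 * R) • e))‖ := norm_sub_le_norm_add _ _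
      _ = _ := by congr 1; abel
  have h6 : ‖x - y‖ ≤ 3 * R := by
    calc ‖x - y‖ = ‖-((2 * R) • e) - (y - (x + (2 * R) • e))‖ := by congr 1; abel
      _ ≤ ‖-((2 * R) • e)‖ + ‖y - (x + (2 * R) • e)‖ := norm_sub_le _ _
      _ ≤ 2 * R + R := by
        rw [norm_neg, norm_smul, he, Real.norm_of_nonneg (by positivity)]; linarith
      _ = _ := by ring
  have hx0 := norm_nonneg x
  have h7 := hle y (by linarith) (by linarith) (by linarith)
  have h8 : Real.exp (-l * (3 * R)) ≤ Real.exp (-l * ‖x - y‖) :=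
    Real.exp_le_exp.2 (by nlinarith)
  exact mul_le_mul ((mul_le_mul_of_nonneg_left h8 hc.le).trans hy) h7 hm
    (besselKernel_nonneg n _)

/-- Lower bound for the source term. -/
theorem exists_source_lower_bound {n : ℕ} (hn : 1 ≤ n) {p σ : ℝ} (hp : 0 ≤ p) (hσ : 0 ≤ σ)
    {Λ : ℝ → ℝ} (hΛpos : ∀ t > 0, 0 < Λ t) {V : EuclideanSpace ℝ (Fin n) → ℝ → ℝ}
    (hV0 : ∀ x, ∀ t > 0, 0 ≤ V x t) (hVlow : PotentialLowerBound n σ Λ V) {K : ℝ} (hK : 1 ≤ K) :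
    ∃ r > 0, ∃ κ > 0, ∀ (x : EuclideanSpace ℝ (Fin n)) (w : EuclideanSpace ℝ (Fin n) → ℝ)
      (τ M : ℝ), 0 < τ → 0 ≤ M → (∀ y, 0 ≤ w y) →
      Integrable (fun y => besselKernel n (x - y) * (V y τ * w y ^ p)) →
      (∀ y, ‖x‖ ≤ ‖y‖ → ‖y‖ ≤ ‖x‖ + r → M ≤ w y) →
      κ * (Λ τ * ((K + ‖x‖ ^ 2) ^ (σ / 2) * M ^ p)) ≤
        besselPotential n (fun y => V y τ * w y ^ p) x := by
  obtain ⟨c, hc, R₀, hV⟩ := hVlow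
  obtain ⟨r, hr, κ, hκ, h⟩ := exists_annulus_le_besselPotential hn R₀
  refine ⟨r, hr, κ * (c * (K ^ (σ / 2))⁻¹), by positivity,
    fun x w τ M hτ hM hw hint hle => ?_⟩
  have hΛτ := hΛpos τ hτ
  have h1 := h x (fun y => V y τ * w y ^ p)
    (c * (Λ τ * (K ^ (σ / 2))⁻¹ * (K + ‖x‖ ^ 2) ^ (σ / 2)) * M ^ p)
    (fun y => mul_nonneg (hV0 y τ hτ) (Real.rpow_nonneg (hw y) p)) hint (by positivity) ?_
  · calc _ = κ * (c * (Λ τ * (K ^ (σ / 2))⁻¹ * (K + ‖x‖ ^ 2) ^ (σ / 2)) * M ^ p) := by ring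
      _ ≤ _ := h1
  · intro y hy0 hy1 hy2
    have h2 : M ^ p ≤ w y ^ p := Real.rpow_le_rpow hM (hle y (by linarith) hy2) hp
    -- On the outer annulus `‖y‖ ≥ ‖x‖ + 1` and `K ≥ 1`, whence `K + ‖x‖² ≤ K‖y‖²`.
    have h3 : (K ^ (σ / 2))⁻¹ * (K + ‖x‖ ^ 2) ^ (σ / 2) ≤ ‖y‖ ^ σ := by
      have h4 : ‖y‖ ^ σ = (‖y‖ ^ 2) ^ (σ / 2) := by
        rw [← Real.rpow_natCast, ← Real.rpow_mul (norm_nonneg y)]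
        congr 1; push_cast; ring
      rw [h4, inv_mul_le_iff₀ (by positivity), ← Real.mul_rpow (by positivity) (by positivity)]
      refine Real.rpow_le_rpow (by positivity) ?_ (by positivity)
      have h5 : (‖x‖ + 1) ^ 2 ≤ ‖y‖ ^ 2 := by gcongr
      nlinarith [norm_nonneg x, sq_nonneg ‖x‖]
    refine mul_le_mul (le_trans ?_ (hV y hy0 τ hτ)) h2 (by positivity) (hV0 y τ hτ)
    rw [mul_assoc]
    gcongr

/-! ### The primitive `Λ_*` and the sublinear growth equation. -/

section Primitive

variable {Λ : ℝ → ℝ}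

theorem intervalIntegrable_of_continuousOn_Ici (hΛc : ContinuousOn Λ (Ici 0)) {s t : ℝ}
    (hs : 0 ≤ s) (ht : 0 ≤ t) : IntervalIntegrable Λ volume s t :=
  (hΛc.mono fun _ hx => (le_min hs ht).trans hx.1).intervalIntegrable

theorem hasDerivAt_primitive (hΛc : ContinuousOn Λ (Ici 0)) {t : ℝ} (ht : 0 < t) :
    HasDerivAt (primitive Λ) (Λ t) t := by
  have hnhds : Ioi (0 : ℝ) ∈ 𝓝 t := Ioi_mem_nhds ht
  refine intervalIntegral.integral_hasDerivAt_right
    (intervalIntegrable_of_continuousOn_Ici hΛc le_rfl ht.le) ?_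
    (hΛc.continuousAt (Ici_mem_nhds ht))
  exact (hΛc.mono Ioi_subset_Ici_self).stronglyMeasurableAtFilter isOpen_Ioi t ht

theorem primitive_sub_eq_integral (hΛc : ContinuousOn Λ (Ici 0)) {s t : ℝ} (hs : 0 ≤ s)
    (ht : 0 ≤ t) : primitive Λ t - primitive Λ s = ∫ τ in s..t, Λ τ :=
  intervalIntegral.integral_interval_sub_left
    (intervalIntegrable_of_continuousOn_Ici hΛc le_rfl ht)
    (intervalIntegrable_of_continuousOn_Ici hΛc le_rfl hs)

theorem primitive_lt_primitive (hΛc : ContinuousOn Λ (Ici 0)) (hΛpos : ∀ t > 0, 0 < Λ t)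
    {s t : ℝ} (hs : 0 ≤ s) (hst : s < t) : primitive Λ s < primitive Λ t := by
  rw [← sub_pos, primitive_sub_eq_integral hΛc hs (hs.trans hst.le)]
  exact intervalIntegral.intervalIntegral_pos_of_pos_on
    (intervalIntegrable_of_continuousOn_Ici hΛc hs (hs.trans hst.le))
    (fun τ hτ => hΛpos τ (hs.trans_lt hτ.1)) hst

theorem primitive_mono (hΛc : ContinuousOn Λ (Ici 0)) (hΛpos : ∀ t > 0, 0 < Λ t)
    {s t : ℝ} (hs : 0 ≤ s) (hst : s ≤ t) : primitive Λ s ≤ primitive Λ t := by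
  rcases hst.eq_or_lt with rfl | h
  · exact le_rfl
  · exact (primitive_lt_primitive hΛc hΛpos hs h).le

theorem primitive_pos (hΛc : ContinuousOn Λ (Ici 0)) (hΛpos : ∀ t > 0, 0 < Λ t)
    {t : ℝ} (ht : 0 < t) : 0 < primitive Λ t := by
  have := primitive_lt_primitive hΛc hΛpos le_rfl ht
  rwa [primitive, intervalIntegral.integral_same] at this

end Primitive

/-- The solution of `m' = κ Λ m^p` with `m(t₁) = A`. -/
noncomputable def sublinearGrowth (p κ A t₁ : ℝ) (Λ : ℝ → ℝ) (t : ℝ) : ℝ :=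
  (A ^ (1 - p) + (1 - p) * κ * (primitive Λ t - primitive Λ t₁)) ^ (1 / (1 - p))

section Growth

variable {p κ A t₁ : ℝ} {Λ : ℝ → ℝ}

theorem sublinearGrowth_base_pos (hp1 : p < 1) (hκ : 0 ≤ κ) (hA : 0 < A)
    (hΛc : ContinuousOn Λ (Ici 0)) (hΛpos : ∀ t > 0, 0 < Λ t) (ht₁ : 0 ≤ t₁) {t : ℝ}
    (ht : t₁ ≤ t) :
    0 < A ^ (1 - p) + (1 - p) * κ * (primitive Λ t - primitive Λ t₁) := by
  have h1 := primitive_mono hΛc hΛpos ht₁ ht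
  have h2 : 0 ≤ (1 - p) * κ * (primitive Λ t - primitive Λ t₁) :=
    mul_nonneg (mul_nonneg (by linarith) hκ) (by linarith)
  positivity

theorem sublinearGrowth_self (hp1 : p < 1) (hA : 0 < A) :
    sublinearGrowth p κ A t₁ Λ t₁ = A := by
  rw [sublinearGrowth, sub_self, mul_zero, add_zero, ← Real.rpow_mul hA.le,
    mul_one_div_cancel (by linarith), Real.rpow_one]

theorem hasDerivAt_sublinearGrowth (hp1 : p < 1) (hκ : 0 ≤ κ) (hA : 0 < A)
    (hΛc : ContinuousOn Λ (Ici 0)) (hΛpos : ∀ t > 0, 0 < Λ t) (ht₁ : 0 < t₁) {t : ℝ}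
    (ht : t₁ ≤ t) :
    HasDerivAt (sublinearGrowth p κ A t₁ Λ) (κ * Λ t * sublinearGrowth p κ A t₁ Λ t ^ p) t := by
  have hpos := sublinearGrowth_base_pos hp1 hκ hA hΛc hΛpos ht₁.le ht
  have hp : 1 - p ≠ 0 := by linarith
  have h1 := ((((hasDerivAt_primitive hΛc (ht₁.trans_le ht)).sub_const (primitive Λ t₁)).const_mul
    ((1 - p) * κ)).const_add (A ^ (1 - p))).rpow_const (p := 1 / (1 - p)) (Or.inl hpos.ne')
  refine h1.congr_deriv ?_
  rw [sublinearGrowth, ← Real.rpow_mul hpos.le,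
    show 1 / (1 - p) * p = 1 / (1 - p) - 1 by field_simp; ring]
  field_simp

theorem sublinearGrowth_pos (hp1 : p < 1) (hκ : 0 ≤ κ) (hA : 0 < A)
    (hΛc : ContinuousOn Λ (Ici 0)) (hΛpos : ∀ t > 0, 0 < Λ t) (ht₁ : 0 ≤ t₁) {t : ℝ}
    (ht : t₁ ≤ t) : 0 < sublinearGrowth p κ A t₁ Λ t :=
  Real.rpow_pos_of_pos (sublinearGrowth_base_pos hp1 hκ hA hΛc hΛpos ht₁ ht) _

theorem sublinearGrowth_mono (hp1 : p < 1) (hκ : 0 ≤ κ) (hA : 0 < A)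
    (hΛc : ContinuousOn Λ (Ici 0)) (hΛpos : ∀ t > 0, 0 < Λ t) (ht₁ : 0 ≤ t₁) {s t : ℝ}
    (hs : t₁ ≤ s) (hst : s ≤ t) :
    sublinearGrowth p κ A t₁ Λ s ≤ sublinearGrowth p κ A t₁ Λ t := by
  have hpos := sublinearGrowth_base_pos hp1 hκ hA hΛc hΛpos ht₁ hs
  have hp : 0 < 1 - p := by linarith
  have h1 := primitive_mono hΛc hΛpos (ht₁.trans hs) hst
  refine Real.rpow_le_rpow hpos.le ?_ (by positivity)
  gcongr

theorem continuousOn_sublinearGrowth_deriv (hp1 : p < 1) (hκ : 0 ≤ κ) (hA : 0 < A)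
    (hΛc : ContinuousOn Λ (Ici 0)) (hΛpos : ∀ t > 0, 0 < Λ t) (ht₁ : 0 < t₁) (T : ℝ) :
    ContinuousOn (fun t => κ * Λ t * sublinearGrowth p κ A t₁ Λ t ^ p) (Icc t₁ T) := by
  refine (continuousOn_const.mul (hΛc.mono fun t ht => ht₁.le.trans ht.1)).mul
    (ContinuousOn.rpow_const (fun t ht => ?_) fun t ht => Or.inl ?_)
  · exact (hasDerivAt_sublinearGrowth hp1 hκ hA hΛc hΛpos ht₁
      ht.1).continuousAt.continuousWithinAt
  · exact (sublinearGrowth_pos hp1 hκ hA hΛc hΛpos ht₁.le ht.1).ne'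

/-- Growth of a solution above a weight `W` for which the source term satisfies
`𝓑[V w^p] ≥ κ Λ M^p W` as soon as `w ≥ M W`. -/
theorem IsGlobalModifiedMild.sublinearGrowth_le {n : ℕ}
    {V : EuclideanSpace ℝ (Fin n) → ℝ → ℝ} {u₀ : EuclideanSpace ℝ (Fin n) → ℝ}
    {μ : EuclideanSpace ℝ (Fin n) → ℝ → ℝ} (h : IsGlobalModifiedMild n p V u₀ μ)
    (hp0 : 0 < p) (hp1 : p < 1) (hκ : 0 < κ) (hA : 0 < A)
    (hΛc : ContinuousOn Λ (Ici 0)) (hΛpos : ∀ t > 0, 0 < Λ t) (ht₁ : 0 < t₁)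
    {W : EuclideanSpace ℝ (Fin n) → ℝ} (hW : ∀ x, 0 < W x) {θ : ℝ} (hθ0 : 0 ≤ θ) (hθ1 : θ ≤ 1)
    (hlin : ∀ x, θ * W x ≤ besselPotential n W x)
    (hsrc : ∀ (x : EuclideanSpace ℝ (Fin n)) (w : EuclideanSpace ℝ (Fin n) → ℝ) (τ M : ℝ),
      0 < τ → 0 ≤ M → (∀ y, 0 ≤ w y) →
      Integrable (fun y => besselKernel n (x - y) * (V y τ * w y ^ p)) →
      (∀ y, M * W y ≤ w y) →
      κ * (Λ τ * (M ^ p * W x)) ≤ besselPotential n (fun y => V y τ * w y ^ p) x)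
    (h0 : ∀ x, Real.exp (θ * t₁) * A * W x ≤ μ x t₁) {t : ℝ} (ht : t₁ ≤ t)
    (x : EuclideanSpace ℝ (Fin n)) :
    Real.exp (θ * t) * sublinearGrowth p κ A t₁ Λ t * W x ≤ μ x t := by
  set m := sublinearGrowth p κ A t₁ Λ with hm
  have hmpos : ∀ s, t₁ ≤ s → 0 < m s := fun s hs =>
    sublinearGrowth_pos hp1 hκ.le hA hΛc hΛpos ht₁.le hs
  have hmA : m t₁ = A := sublinearGrowth_self hp1 hA
  have hAt : A ≤ m t := by
    rw [← hmA]; exact sublinearGrowth_mono hp1 hκ.le hA hΛc hΛpos ht₁.le le_rfl ht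
  have hmt := hmpos t ht
  have hexp : ∀ s : ℝ, HasDerivAt (fun s => Real.exp (θ * s)) (Real.exp (θ * s) * θ) s :=
    fun s => by simpa using ((hasDerivAt_id s).const_mul θ).exp
  -- The factor `e^{θs}` is driven by the linear term and `m` by the source. As `E` increases in
  -- time, `η = E(t₁)/E(t)` is admissible, and it does not depend on `x`.
  refine h.le_of_subsolution (E := fun x s => Real.exp (θ * s) * m s * W x)
    (D := fun x s => (Real.exp (θ * s) * θ * m s + Real.exp (θ * s) * (κ * Λ s * m s ^ p)) * W x)
    (t₁ := t₁) (T := t) (η := Real.exp (-(θ * (t - t₁))) * (A / m t)) ht₁.le (by positivity) ?_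
    (fun x s hs => ((hexp s).mul (hasDerivAt_sublinearGrowth hp1 hκ.le hA hΛc hΛpos ht₁
      hs.1)).mul_const (W x)) ?_ ?_ ?_ ?_ x t ⟨ht, le_rfl⟩
  · refine mul_le_one₀ (Real.exp_le_one_iff.2 ?_) (by positivity) ((div_le_one hmt).2 hAt)
    have := mul_nonneg hθ0 (sub_nonneg.2 ht)
    linarith
  · intro x
    have hc := continuousOn_sublinearGrowth_deriv hp1 hκ.le hA hΛc hΛpos ht₁ t
    have hmc : ContinuousOn m (Icc t₁ t) := fun s hs => (hasDerivAt_sublinearGrowth hp1 hκ.le hA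
      hΛc hΛpos ht₁ hs.1).continuousAt.continuousWithinAt
    have he : Continuous fun s => Real.exp (θ * s) := by fun_prop
    exact (((he.continuousOn.mul continuousOn_const).mul hmc).add
      (he.continuousOn.mul hc)).mul continuousOn_const
  · intro x s hs
    rw [hmA]
    have h1 : m s ≤ m t := sublinearGrowth_mono hp1 hκ.le hA hΛc hΛpos ht₁.le hs.1 hs.2
    have h2 : Real.exp (-(θ * (t - t₁))) * Real.exp (θ * s) ≤ Real.exp (θ * t₁) := by
      rw [← Real.exp_add]
      refine Real.exp_le_exp.2 ?_
      nlinarith [mul_nonneg hθ0 (sub_nonneg.2 hs.2)]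
    have hWx := hW x
    have hms := hmpos s hs.1
    have h3 : A / m t * m s ≤ A := by
      rw [div_mul_eq_mul_div, div_le_iff₀ hmt]; gcongr
    calc _ = (Real.exp (-(θ * (t - t₁))) * Real.exp (θ * s)) * (A / m t * m s) * W x := by ring
      _ ≤ _ := by gcongr
  · intro x
    rw [hmA]; exact h0 x
  · intro β hβ hle x
    filter_upwards [h.ae_integrable_source x t] with τ hint hτ
    have hτ0 : 0 < τ := ht₁.trans hτ.1
    have hmτ := hmpos τ hτ.1.le
    have hΛτ := hΛpos τ hτ0
    have hWx := hW x
    have hle' : ∀ y, β * (Real.exp (θ * τ) * m τ) * W y ≤ μ y τ := fun y => by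
      have := hle y τ ⟨hτ.1.le, hτ.2⟩
      simpa [mul_assoc] using this
    have hcoef : 0 ≤ β * (Real.exp (θ * τ) * m τ) := mul_nonneg hβ.1 (by positivity)
    have hl : β * (Real.exp (θ * τ) * m τ) * (θ * W x) ≤
        besselPotential n (fun y => μ y τ) x := by
      refine (mul_le_mul_of_nonneg_left (hlin x) hcoef).trans ?_
      rw [← besselPotential_const_mul]
      exact besselPotential_mono (fun y => mul_nonneg hcoef (hW y).le) hle'
        (h.integrable_linear x hτ0.le)
    have hs := hsrc x (fun y => μ y τ) τ _ hτ0 hcoef (fun y => h.nonneg y τ hτ0.le)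
      (hint ⟨hτ0, hτ.2⟩) hle'
    have hβp0 := Real.rpow_nonneg hβ.1 p
    -- Sublinearity: scaling a subsolution down by `β ≤ 1` keeps it a subsolution.
    have hβp : β ≤ β ^ p := by
      rcases hβ.1.eq_or_lt with h0 | h0
      · rw [← h0, Real.zero_rpow hp0.ne']
      · simpa using Real.rpow_le_rpow_of_exponent_ge h0 hβ.2 hp1.le
    -- Equality at `θ = 1`, when the full linear growth is kept; `θ = 0` discards the linear term
    -- and then needs nothing of `𝓑W` beyond its sign.
    have hee : Real.exp (θ * τ) ≤ Real.exp ((1 - p) * τ) * Real.exp (θ * τ) ^ p := by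
      rw [← Real.exp_mul, ← Real.exp_add]
      refine Real.exp_le_exp.2 ?_
      have : 0 ≤ (1 - p) * (1 - θ) * τ :=
        mul_nonneg (mul_nonneg (by linarith) (by linarith)) hτ0.le
      nlinarith
    have hpow : (β * (Real.exp (θ * τ) * m τ)) ^ p =
        β ^ p * (Real.exp (θ * τ) ^ p * m τ ^ p) := by
      rw [Real.mul_rpow hβ.1 (by positivity), Real.mul_rpow (by positivity) hmτ.le]
    have hn : β * (Real.exp (θ * τ) * (κ * Λ τ * m τ ^ p) * W x) ≤ Real.exp ((1 - p) * τ) *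
        besselPotential n (fun y => V y τ * μ y τ ^ p) x := by
      refine le_trans ?_ (mul_le_mul_of_nonneg_left hs (Real.exp_pos _).le)
      rw [hpow]
      calc _ ≤ β ^ p * ((Real.exp ((1 - p) * τ) * Real.exp (θ * τ) ^ p) *
            (κ * Λ τ * m τ ^ p) * W x) := by gcongr
        _ = _ := by ring
    rw [mildRate]
    calc _ = β * (Real.exp (θ * τ) * m τ) * (θ * W x) +
          β * (Real.exp (θ * τ) * (κ * Λ τ * m τ ^ p) * W x) := by ring
      _ ≤ _ := add_le_add hl hn

end Growth

/-! ### Positivity and lower bounds independent of the initial datum. -/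

namespace IsGlobalModifiedMild

variable {n : ℕ} {p : ℝ} {V : EuclideanSpace ℝ (Fin n) → ℝ → ℝ}
  {u₀ : EuclideanSpace ℝ (Fin n) → ℝ} {μ : EuclideanSpace ℝ (Fin n) → ℝ → ℝ}

theorem source_nonneg (h : IsGlobalModifiedMild n p V u₀ μ) (hV0 : ∀ x, ∀ t > 0, 0 ≤ V x t)
    (x : EuclideanSpace ℝ (Fin n)) {τ : ℝ} (hτ : 0 < τ) :
    0 ≤ Real.exp ((1 - p) * τ) * besselPotential n (fun y => V y τ * μ y τ ^ p) x :=
  mul_nonneg (Real.exp_pos _).le (besselPotential_nonneg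
    (fun y => mul_nonneg (hV0 y τ hτ) (Real.rpow_nonneg (h.nonneg y τ hτ.le) p)) x)

theorem linear_nonneg (h : IsGlobalModifiedMild n p V u₀ μ)
    (x : EuclideanSpace ℝ (Fin n)) {τ : ℝ} (hτ : 0 ≤ τ) :
    0 ≤ besselPotential n (fun y => μ y τ) x :=
  besselPotential_nonneg (fun y => h.nonneg y τ hτ) x

theorem mono (h : IsGlobalModifiedMild n p V u₀ μ) (hV0 : ∀ x, ∀ t > 0, 0 ≤ V x t)
    (x : EuclideanSpace ℝ (Fin n)) {s t : ℝ} (hs : 0 ≤ s) (hst : s ≤ t) : μ x s ≤ μ x t := by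
  have := h.add_integral_le x hs hst (φ := fun _ => 0) intervalIntegrable_const
    (.of_forall fun τ hτ => add_nonneg (h.linear_nonneg x (hs.trans hτ.1.le))
      (h.source_nonneg hV0 x (hs.trans_lt hτ.1)))
  simpa using this

theorem apply_zero (h : IsGlobalModifiedMild n p V u₀ μ) (x : EuclideanSpace ℝ (Fin n)) :
    μ x 0 = u₀ x := by
  simpa using h.eqn x 0 le_rfl

end IsGlobalModifiedMild

/-- Nontrivial solutions become positive instantaneously, with an exponential lower bound at
infinity. -/
theorem exists_exp_le_solution (n : ℕ) : ∃ l > 0, ∀ {p : ℝ}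
    {V : EuclideanSpace ℝ (Fin n) → ℝ → ℝ} {u₀ : EuclideanSpace ℝ (Fin n) → ℝ}
    {μ : EuclideanSpace ℝ (Fin n) → ℝ → ℝ}, IsGlobalModifiedMild n p V u₀ μ →
    (∀ x, ∀ t > 0, 0 ≤ V x t) → Continuous u₀ → (∀ x, 0 ≤ u₀ x) → u₀ ≠ 0 →
    ∀ t > 0, ∃ A > 0, ∀ x, A * Real.exp (-(l * ‖x‖)) ≤ μ x t := by
  obtain ⟨c, hc, l, hl, hB⟩ := exists_exp_le_besselKernel n
  refine ⟨l, hl, fun {p V u₀ μ} h hV0 hu₀c hu₀0 hne t ht => ?_⟩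
  obtain ⟨x₀, hx₀⟩ := Function.ne_iff.1 hne
  have hx₀ : 0 < u₀ x₀ := lt_of_le_of_ne (hu₀0 x₀) (Ne.symm hx₀)
  obtain ⟨r, hr, hball⟩ := Metric.eventually_nhds_iff_ball.1
    (hu₀c.continuousAt.eventually (lt_mem_nhds (half_lt_self hx₀)))
  set δ := u₀ x₀ / 2 with hδ
  have hδ0 : 0 < δ := by positivity
  set v := (volume : Measure (EuclideanSpace ℝ (Fin n))).real (Metric.ball x₀ r) with hv
  have hvpos : 0 < v :=
    ENNReal.toReal_pos (Metric.measure_ball_pos _ _ hr).ne' measure_ball_lt_top.ne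
  refine ⟨t * (v * (c * Real.exp (-l * (‖x₀‖ + r)) * δ)), by positivity, fun x => ?_⟩
  -- Monotonicity in time preserves `μ ≥ δ` on the ball about `x₀`; the exponential tail of the
  -- kernel carries this mass to every `x`.
  have key : ∀ τ ∈ Ioc 0 t, v * (c * Real.exp (-l * (‖x₀‖ + r)) * δ) * Real.exp (-(l * ‖x‖)) ≤
      besselPotential n (fun y => μ y τ) x := by
    intro τ hτ
    have hint := h.integrable_linear x hτ.1.le
    have h1 : ∫ y in Metric.ball x₀ r, besselKernel n (x - y) * μ y τ ≤
        besselPotential n (fun y => μ y τ) x :=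
      setIntegral_le_integral hint
        (.of_forall fun y => mul_nonneg (besselKernel_nonneg n _) (h.nonneg y τ hτ.1.le))
    refine le_trans ?_ h1
    have h2 : ∫ y in Metric.ball x₀ r,
        c * Real.exp (-l * (‖x₀‖ + r)) * δ * Real.exp (-(l * ‖x‖)) =
        v * (c * Real.exp (-l * (‖x₀‖ + r)) * δ) * Real.exp (-(l * ‖x‖)) := by
      rw [setIntegral_const, smul_eq_mul, ← mul_assoc]
    rw [← h2]
    refine setIntegral_mono_on_ae (integrableOn_const measure_ball_lt_top.ne) hint.integrableOn
      measurableSet_ball ?_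
    filter_upwards [(Measure.measurePreserving_sub_left volume x).quasiMeasurePreserving.ae hB]
      with y hy hyQ
    have h3 : δ ≤ μ y τ := by
      have := h.mono hV0 y le_rfl hτ.1.le
      rw [h.apply_zero] at this
      exact (hball y hyQ).le.trans this
    have h4 : ‖x - y‖ ≤ ‖x‖ + (‖x₀‖ + r) := by
      have h5 : ‖y - x₀‖ ≤ r := by
        rw [← dist_eq_norm]; exact (Metric.mem_ball.1 hyQ).le
      have h6 : ‖y‖ ≤ ‖y - x₀‖ + ‖x₀‖ := by
        simpa using norm_add_le (y - x₀) x₀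
      have := norm_sub_le x y
      linarith
    calc _ = c * (Real.exp (-l * (‖x₀‖ + r)) * Real.exp (-(l * ‖x‖))) * δ := by ring
      _ ≤ c * Real.exp (-l * ‖x - y‖) * δ := by
        rw [← Real.exp_add]
        have : -l * (‖x₀‖ + r) + -(l * ‖x‖) ≤ -l * ‖x - y‖ := by nlinarith
        have := Real.exp_le_exp.2 this
        gcongr
      _ ≤ _ := mul_le_mul hy h3 hδ0.le (besselKernel_nonneg n _)
  have h1 := h.add_integral_le x le_rfl ht.le (φ := fun _ =>
    v * (c * Real.exp (-l * (‖x₀‖ + r)) * δ) * Real.exp (-(l * ‖x‖))) intervalIntegrable_const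
    (.of_forall fun τ hτ => (key τ hτ).trans
      (le_add_of_nonneg_right (h.source_nonneg hV0 x hτ.1)))
  rw [intervalIntegral.integral_const, sub_zero, smul_eq_mul] at h1
  have h2 := h.nonneg x 0 le_rfl
  linarith

/-- Interpolation between the weight `(K + |x|²)^q` (at `θ = 0`) and `e^{-l|x|}` (at `θ = 1`). -/
noncomputable def interpWeight (n : ℕ) (K q l θ : ℝ) (x : EuclideanSpace ℝ (Fin n)) : ℝ :=
  (K + ‖x‖ ^ 2) ^ (q * (1 - θ)) * Real.exp (-(l * θ * ‖x‖))

section InterpWeight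

variable {n : ℕ} {K q l θ : ℝ}

theorem interpWeight_zero (x : EuclideanSpace ℝ (Fin n)) :
    interpWeight n K q l 0 x = (K + ‖x‖ ^ 2) ^ q := by
  simp [interpWeight]

theorem interpWeight_one (x : EuclideanSpace ℝ (Fin n)) :
    interpWeight n K q l 1 x = Real.exp (-(l * ‖x‖)) := by
  simp [interpWeight]

theorem interpWeight_pos (hK : 1 ≤ K) (x : EuclideanSpace ℝ (Fin n)) :
    0 < interpWeight n K q l θ x := by
  have : 0 < K + ‖x‖ ^ 2 := by positivity
  rw [interpWeight]; positivity

theorem interpWeight_anti (hK : 1 ≤ K) (hq : 0 ≤ q) (hl : 0 ≤ l) {θ' : ℝ} (h : θ ≤ θ')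
    (x : EuclideanSpace ℝ (Fin n)) :
    interpWeight n K q l θ' x ≤ interpWeight n K q l θ x := by
  rw [interpWeight, interpWeight]
  have h1 : 1 ≤ K + ‖x‖ ^ 2 := by nlinarith [sq_nonneg ‖x‖]
  have h2 : (K + ‖x‖ ^ 2) ^ (q * (1 - θ')) ≤ (K + ‖x‖ ^ 2) ^ (q * (1 - θ)) :=
    Real.rpow_le_rpow_of_exponent_le h1 (by nlinarith)
  have h3 : Real.exp (-(l * θ' * ‖x‖)) ≤ Real.exp (-(l * θ * ‖x‖)) := by
    refine Real.exp_le_exp.2 (neg_le_neg ?_)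
    gcongr
  gcongr

/-- The loss `e^{-lr}` is uniform in `θ ∈ [0,1]`, so a single source constant serves for all the
weights `θ = p^k`. -/
theorem interpWeight_le_of_annulus (hK : 1 ≤ K) (hq : 0 ≤ q) (hl : 0 ≤ l) (hθ0 : 0 ≤ θ)
    (hθ1 : θ ≤ 1) {r : ℝ} (hr : 0 ≤ r) {x y : EuclideanSpace ℝ (Fin n)} (hxy : ‖x‖ ≤ ‖y‖)
    (hyx : ‖y‖ ≤ ‖x‖ + r) :
    Real.exp (-(l * r)) * interpWeight n K q l θ x ≤ interpWeight n K q l θ y := by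
  rw [interpWeight, interpWeight]
  have h2 : (K + ‖x‖ ^ 2) ^ (q * (1 - θ)) ≤ (K + ‖y‖ ^ 2) ^ (q * (1 - θ)) := by
    refine Real.rpow_le_rpow (by positivity) ?_ (mul_nonneg hq (by linarith))
    gcongr
  have h3 : Real.exp (-(l * r)) * Real.exp (-(l * θ * ‖x‖)) ≤ Real.exp (-(l * θ * ‖y‖)) := by
    rw [← Real.exp_add]
    refine Real.exp_le_exp.2 ?_
    have h4 : l * θ * ‖y‖ ≤ l * θ * (‖x‖ + r) := by gcongr
    have h5 : l * r * θ ≤ l * r * 1 := by gcongr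
    linarith
  calc _ = (K + ‖x‖ ^ 2) ^ (q * (1 - θ)) * (Real.exp (-(l * r)) * Real.exp (-(l * θ * ‖x‖))) := by
        ring
    _ ≤ _ := by gcongr

/-- The choice of `q` means `σ/2 = q(1-p)`, hence `σ/2 + pq(1-θ) = q(1-pθ)`. The source thus
contracts `θ` towards its fixed point `0`. -/
theorem interpWeight_rpow_mul (hK : 1 ≤ K) {p σ : ℝ} (hp1 : p < 1) (hq : q = σ / (2 * (1 - p)))
    (x : EuclideanSpace ℝ (Fin n)) :
    (K + ‖x‖ ^ 2) ^ (σ / 2) * interpWeight n K q l θ x ^ p = interpWeight n K q l (p * θ) x := by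
  have h0 : 0 < K + ‖x‖ ^ 2 := by positivity
  rw [interpWeight, interpWeight, Real.mul_rpow (by positivity) (by positivity),
    ← Real.rpow_mul h0.le, ← Real.exp_mul, ← mul_assoc, ← Real.rpow_add h0]
  have h1 : 1 - p ≠ 0 := by linarith
  congr 2
  · rw [hq]; field_simp; ring
  · ring

theorem tendsto_interpWeight (hK : 1 ≤ K) {p : ℝ} (hp0 : 0 ≤ p) (hp1 : p < 1)
    (x : EuclideanSpace ℝ (Fin n)) :
    Tendsto (fun k : ℕ => interpWeight n K q l (p ^ k) x) atTop (𝓝 ((K + ‖x‖ ^ 2) ^ q)) := by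
  have h0 : 0 < K + ‖x‖ ^ 2 := by positivity
  have hc : Continuous fun θ : ℝ => interpWeight n K q l θ x := by
    unfold interpWeight
    refine (Continuous.rpow continuous_const (by fun_prop) fun _ => Or.inl h0.ne').mul ?_
    fun_prop
  have := (hc.tendsto 0).comp (tendsto_pow_atTop_nhds_zero_of_lt_one hp0 hp1)
  rwa [interpWeight_zero] at this

/-- The source term maps a multiple of the weight with parameter `θ` above a multiple of the weight
with parameter `pθ`. -/
theorem exists_source_interpWeight (hn : 1 ≤ n) {p σ : ℝ} (hp0 : 0 < p) (hp1 : p < 1)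
    (hσ : 0 ≤ σ) {Λ : ℝ → ℝ} (hΛpos : ∀ t > 0, 0 < Λ t) {V : EuclideanSpace ℝ (Fin n) → ℝ → ℝ}
    (hV0 : ∀ x, ∀ t > 0, 0 ≤ V x t) (hVlow : PotentialLowerBound n σ Λ V) (hK : 1 ≤ K)
    (hl : 0 ≤ l) (hq : q = σ / (2 * (1 - p))) :
    ∃ κ > 0, ∀ θ ∈ Icc (0 : ℝ) 1, ∀ (x : EuclideanSpace ℝ (Fin n))
      (w : EuclideanSpace ℝ (Fin n) → ℝ) (τ M : ℝ), 0 < τ → 0 ≤ M → (∀ y, 0 ≤ w y) →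
      Integrable (fun y => besselKernel n (x - y) * (V y τ * w y ^ p)) →
      (∀ y, M * interpWeight n K q l θ y ≤ w y) →
      κ * (Λ τ * (M ^ p * interpWeight n K q l (p * θ) x)) ≤
        besselPotential n (fun y => V y τ * w y ^ p) x := by
  obtain ⟨r, hr, κ, hκ, h⟩ := exists_source_lower_bound hn hp0.le hσ hΛpos hV0 hVlow hK
  have hq0 : 0 ≤ q := by rw [hq]; exact div_nonneg hσ (by linarith)
  refine ⟨κ * Real.exp (-(l * r)) ^ p, by positivity, fun θ hθ x w τ M hτ hM hw hint hle => ?_⟩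
  have hWx := interpWeight_pos (q := q) (l := l) (θ := θ) hK x
  have h1 := h x w τ (M * (Real.exp (-(l * r)) * interpWeight n K q l θ x)) hτ (by positivity) hw
    hint fun y hy1 hy2 => (mul_le_mul_of_nonneg_left
      (interpWeight_le_of_annulus hK hq0 hl hθ.1 hθ.2 hr.le hy1 hy2) hM).trans (hle y)
  rw [Real.mul_rpow hM (by positivity), Real.mul_rpow (by positivity) hWx.le] at h1
  rw [← interpWeight_rpow_mul hK hp1 hq]
  refine le_trans (le_of_eq ?_) h1
  ring

end InterpWeight

/-- One integration of the source over `[t/2, t]` replaces `θ` by `pθ`. The constant `A` may depend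
on `k`, `t` and the solution; that dependence is removed afterwards by sublinear growth. -/
theorem IsGlobalModifiedMild.exists_interpWeight_le {n : ℕ} {p : ℝ}
    {V : EuclideanSpace ℝ (Fin n) → ℝ → ℝ} {u₀ : EuclideanSpace ℝ (Fin n) → ℝ}
    {μ : EuclideanSpace ℝ (Fin n) → ℝ → ℝ} (h : IsGlobalModifiedMild n p V u₀ μ)
    (hp0 : 0 < p) (hp1 : p < 1) {Λ : ℝ → ℝ} (hΛc : ContinuousOn Λ (Ici 0))
    (hΛpos : ∀ t > 0, 0 < Λ t) (hV0 : ∀ x, ∀ t > 0, 0 ≤ V x t) {K q l κ : ℝ} (hK : 1 ≤ K)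
    (hκ : 0 < κ)
    (hsrc : ∀ θ ∈ Icc (0 : ℝ) 1, ∀ (x : EuclideanSpace ℝ (Fin n))
      (w : EuclideanSpace ℝ (Fin n) → ℝ) (τ M : ℝ), 0 < τ → 0 ≤ M → (∀ y, 0 ≤ w y) →
      Integrable (fun y => besselKernel n (x - y) * (V y τ * w y ^ p)) →
      (∀ y, M * interpWeight n K q l θ y ≤ w y) →
      κ * (Λ τ * (M ^ p * interpWeight n K q l (p * θ) x)) ≤
        besselPotential n (fun y => V y τ * w y ^ p) x)
    (h0 : ∀ t > 0, ∃ A > 0, ∀ x, A * Real.exp (-(l * ‖x‖)) ≤ μ x t) (k : ℕ) :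
    ∀ t > 0, ∃ A > 0, ∀ x, A * interpWeight n K q l (p ^ k) x ≤ μ x t := by
  induction k with
  | zero =>
    intro t ht
    simpa only [pow_zero, interpWeight_one] using h0 t ht
  | succ k ih =>
    intro t ht
    have ht2 : 0 < t / 2 := by positivity
    obtain ⟨A, hA, hle⟩ := ih (t / 2) ht2
    have hP := primitive_lt_primitive hΛc hΛpos ht2.le (half_lt_self ht)
    refine ⟨(primitive Λ t - primitive Λ (t / 2)) * (κ * A ^ p),
      mul_pos (sub_pos.2 hP) (by positivity), fun x => ?_⟩
    have hWx := interpWeight_pos (q := q) (l := l) (θ := p ^ (k + 1)) hK x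
    have h1 := h.add_integral_le x ht2.le (half_le_self ht.le)
      (φ := fun τ => Λ τ * (κ * A ^ p * interpWeight n K q l (p ^ (k + 1)) x))
      ((intervalIntegrable_of_continuousOn_Ici hΛc ht2.le ht.le).mul_const _) (by
        filter_upwards [h.ae_integrable_source x t] with τ hint hτ
        have hτ0 : 0 < τ := ht2.trans hτ.1
        have hs := hsrc (p ^ k) ⟨by positivity, pow_le_one₀ hp0.le hp1.le⟩ x (fun y => μ y τ) τ A
          hτ0 hA.le (fun y => h.nonneg y τ hτ0.le) (hint ⟨hτ0, hτ.2⟩)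
          (fun y => (hle y).trans (h.mono hV0 y ht2.le hτ.1.le))
        rw [← pow_succ'] at hs
        have hs0 : 0 ≤ besselPotential n (fun y => V y τ * μ y τ ^ p) x :=
          besselPotential_nonneg (fun y => mul_nonneg (hV0 y τ hτ0)
            (Real.rpow_nonneg (h.nonneg y τ hτ0.le) p)) x
        have he : 1 ≤ Real.exp ((1 - p) * τ) :=
          Real.one_le_exp (mul_nonneg (by linarith) hτ0.le)
        calc _ = κ * (Λ τ * (A ^ p * interpWeight n K q l (p ^ (k + 1)) x)) := by ring
          _ ≤ _ := hs
          _ ≤ _ := le_mul_of_one_le_left hs0 he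
          _ ≤ _ := le_add_of_nonneg_left (h.linear_nonneg x hτ0.le))
    rw [intervalIntegral.integral_mul_const, ← primitive_sub_eq_integral hΛc ht2.le ht.le] at h1
    have h2 := h.nonneg x (t / 2) ht2.le
    calc _ = (primitive Λ t - primitive Λ (t / 2)) *
          (κ * A ^ p * interpWeight n K q l (p ^ (k + 1)) x) := by ring
      _ ≤ _ := by linarith

/-- Lower bound with a constant that does not depend on the solution. -/
theorem exists_static_lower_bound {n : ℕ} (hn : 1 ≤ n) {p : ℝ} (hp0 : 0 < p) (hp1 : p < 1)
    {σ : ℝ} (hσ : 0 ≤ σ) {Λ : ℝ → ℝ} (hΛc : ContinuousOn Λ (Ici 0)) (hΛpos : ∀ t > 0, 0 < Λ t)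
    {V : EuclideanSpace ℝ (Fin n) → ℝ → ℝ} (hV0 : ∀ x, ∀ t > 0, 0 ≤ V x t)
    (hVlow : PotentialLowerBound n σ Λ V) {K : ℝ} (hK : 1 ≤ K)
    (hsub : ∀ x : EuclideanSpace ℝ (Fin n), (K + ‖x‖ ^ 2) ^ (σ / (2 * (1 - p))) ≤
      besselPotential n (fun y => (K + ‖y‖ ^ 2) ^ (σ / (2 * (1 - p)))) x) :
    ∃ C > 0, ∀ (u₀ : EuclideanSpace ℝ (Fin n) → ℝ) (μ : EuclideanSpace ℝ (Fin n) → ℝ → ℝ),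
      Continuous u₀ → (∀ x, 0 ≤ u₀ x) → u₀ ≠ 0 → IsGlobalModifiedMild n p V u₀ μ →
      ∀ t, 2 ≤ t → ∀ x, Real.exp t * (C * primitive Λ t ^ (1 / (1 - p))) *
        (K + ‖x‖ ^ 2) ^ (σ / (2 * (1 - p))) ≤ μ x t := by
  obtain ⟨l, hl, hstart⟩ := exists_exp_le_solution n
  set q := σ / (2 * (1 - p)) with hq
  have hq0 : 0 ≤ q := div_nonneg hσ (by linarith)
  obtain ⟨κ, hκ, hsrc⟩ := exists_source_interpWeight (q := q) hn hp0 hp1 hσ hΛpos hV0 hVlow hK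
    hl.le hq
  have hp : 0 < 1 - p := by linarith
  have hP12 := primitive_lt_primitive hΛc hΛpos zero_le_one one_lt_two
  have hP2 := primitive_pos hΛc hΛpos two_pos
  set a := ((1 - p) * κ * (primitive Λ 2 - primitive Λ 1)) ^ (1 / (1 - p)) with ha
  have hbase : 0 < (1 - p) * κ * (primitive Λ 2 - primitive Λ 1) :=
    mul_pos (by positivity) (sub_pos.2 hP12)
  have ha0 : 0 < a := Real.rpow_pos_of_pos hbase _
  set A := Real.exp (-2) * a with hA
  have hA0 : 0 < A := by positivity
  -- Chosen so that `C₀Λ_*(t) ≤ A^{1-p} + (1-p)κ(Λ_*(t) - Λ_*(2))`, after splitting `Λ_*(t)` at time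
  -- 2.
  set C₀ := min ((1 - p) * κ) (A ^ (1 - p) / primitive Λ 2) with hC₀
  have hC₀0 : 0 < C₀ := lt_min (by positivity) (by positivity)
  refine ⟨C₀ ^ (1 / (1 - p)), by positivity, fun u₀ μ hu₀c hu₀0 hne h t ht x => ?_⟩
  have hall := h.exists_interpWeight_le hp0 hp1 hΛc hΛpos hV0 hK hκ hsrc
    (hstart h hV0 hu₀c hu₀0 hne)
  -- The growth on `[1,2]` with `θ = 0` is bounded below by `a` whatever the starting constant `B`,
  -- so `k → ∞` is harmless. The source produces the weight `p^(k+1)`, which dominates the weight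
  -- `p^k`.
  have huniv : ∀ x, a * (K + ‖x‖ ^ 2) ^ q ≤ μ x 2 := by
    intro x
    refine le_of_tendsto' ((tendsto_interpWeight (l := l) hK hp0.le hp1 x).const_mul a)
      fun k => ?_
    obtain ⟨B, hB, hle⟩ := hall k 1 one_pos
    have hpk : p ^ k ∈ Icc (0 : ℝ) 1 := ⟨by positivity, pow_le_one₀ hp0.le hp1.le⟩
    have h1 := h.sublinearGrowth_le (Λ := Λ) hp0 hp1 hκ hB hΛc hΛpos one_pos
      (W := interpWeight n K q l (p ^ k)) (fun x => interpWeight_pos hK x) le_rfl zero_le_one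
      (fun x => by
        rw [zero_mul]
        exact besselPotential_nonneg (fun y => (interpWeight_pos hK y).le) x)
      (fun x w τ M hτ hM hw hint hle => by
        have hΛτ := hΛpos τ hτ
        refine le_trans ?_ (hsrc (p ^ k) hpk x w τ M hτ hM hw hint hle)
        gcongr
        exact interpWeight_anti hK hq0 hl.le (mul_le_of_le_one_left hpk.1 hp1.le) x)
      (fun x => by simpa using hle x) one_le_two x
    refine le_trans ?_ h1
    rw [zero_mul, Real.exp_zero, one_mul]
    refine mul_le_mul_of_nonneg_right ?_ (interpWeight_pos hK x).le
    refine Real.rpow_le_rpow hbase.le ?_ (by positivity)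
    have : 0 ≤ B ^ (1 - p) := by positivity
    linarith
  -- Now the linear term is used in full, since `(K+‖x‖²)^q` is subharmonic for `𝓑`; the factor
  -- `e^{-2}` in `A` compensates `e^{θt₁}` at `t₁ = 2`.
  have h1 := h.sublinearGrowth_le (Λ := Λ) hp0 hp1 hκ hA0 hΛc hΛpos two_pos
    (W := fun x => (K + ‖x‖ ^ 2) ^ q) (fun x => by positivity) zero_le_one le_rfl
    (fun x => by simpa using hsub x)
    (fun x w τ M hτ hM hw hint hle => by
      have := hsrc 0 ⟨le_rfl, zero_le_one⟩ x w τ M hτ hM hw hint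
        (fun y => by rw [interpWeight_zero]; exact hle y)
      rwa [mul_zero, interpWeight_zero] at this)
    (fun x => by
      rw [hA, ← mul_assoc, ← Real.exp_add]
      simpa using huniv x) ht x
  refine le_trans ?_ h1
  rw [one_mul]
  have hPt := primitive_mono hΛc hΛpos two_pos.le ht
  gcongr
  rw [sublinearGrowth, ← Real.mul_rpow hC₀0.le (hP2.le.trans hPt)]
  refine Real.rpow_le_rpow (mul_nonneg hC₀0.le (hP2.le.trans hPt)) ?_ (by positivity)
  have h2 : C₀ * (primitive Λ t - primitive Λ 2) ≤
      (1 - p) * κ * (primitive Λ t - primitive Λ 2) :=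
    mul_le_mul_of_nonneg_right (min_le_left _ _) (sub_nonneg.2 hPt)
  have h3 : C₀ * primitive Λ 2 ≤ A ^ (1 - p) := by
    rw [← le_div_iff₀ hP2]; exact min_le_right _ _
  linarith

/-! ### Spreading at the diffusive scale and the pointwise bound. -/

/-- The speed `γ = c/q` makes the time derivative of `e^τ b (K+γ(τ-s)+‖x‖²)^q` equal to the lower
bound for its Bessel potential; the source is only used to be nonnegative. -/
theorem exists_spreading {n : ℕ} {K q c : ℝ} (hK : 1 ≤ K) (hq : 0 < q) (hc : 0 < c)
    (hsub : ∀ s ≥ K, ∀ x : EuclideanSpace ℝ (Fin n),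
      (s + ‖x‖ ^ 2) ^ q * (1 + c / (s + ‖x‖ ^ 2)) ≤
        besselPotential n (fun y => (s + ‖y‖ ^ 2) ^ q) x) :
    ∃ γ > 0, ∀ {p : ℝ} {V : EuclideanSpace ℝ (Fin n) → ℝ → ℝ}
      {u₀ : EuclideanSpace ℝ (Fin n) → ℝ} {μ : EuclideanSpace ℝ (Fin n) → ℝ → ℝ},
      IsGlobalModifiedMild n p V u₀ μ → (∀ x, ∀ t > 0, 0 ≤ V x t) → ∀ s b : ℝ, 0 ≤ s → 0 ≤ b →
      (∀ x, Real.exp s * b * (K + ‖x‖ ^ 2) ^ q ≤ μ x s) → ∀ t, s ≤ t → ∀ x,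
      Real.exp t * b * (K + γ * (t - s) + ‖x‖ ^ 2) ^ q ≤ μ x t := by
  refine ⟨c / q, by positivity, fun {p V u₀ μ} h hV0 s b hs hb h0 t ht x => ?_⟩
  set γ := c / q with hγ
  have hγ0 : 0 < γ := by positivity
  have hρ : ∀ τ, s ≤ τ → ∀ x : EuclideanSpace ℝ (Fin n),
      0 < K + γ * (τ - s) + ‖x‖ ^ 2 := fun τ hτ x => by
    have := mul_nonneg hγ0.le (sub_nonneg.2 hτ)
    positivity
  have hts : 0 ≤ t - s := sub_nonneg.2 ht
  have hder : ∀ x : EuclideanSpace ℝ (Fin n), ∀ τ, s ≤ τ → HasDerivAt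
      (fun τ => Real.exp τ * b * (K + γ * (τ - s) + ‖x‖ ^ 2) ^ q)
      (Real.exp τ * b * ((K + γ * (τ - s) + ‖x‖ ^ 2) ^ q *
        (1 + c / (K + γ * (τ - s) + ‖x‖ ^ 2)))) τ := by
    intro x τ hτ
    have hpos := hρ τ hτ x
    have h1 : HasDerivAt (fun τ => K + γ * (τ - s) + ‖x‖ ^ 2) γ τ := by
      simpa using ((((hasDerivAt_id τ).sub_const s).const_mul γ).const_add K).add_const (‖x‖ ^ 2)
    refine (((Real.hasDerivAt_exp τ).mul_const b).mul
      (h1.rpow_const (p := q) (Or.inl hpos.ne'))).congr_deriv ?_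
    rw [Real.rpow_sub_one hpos.ne', hγ]
    field_simp
  refine h.le_of_subsolution (t₁ := s) (T := t)
    (E := fun x τ => Real.exp τ * b * (K + γ * (τ - s) + ‖x‖ ^ 2) ^ q)
    (D := fun x τ => Real.exp τ * b * ((K + γ * (τ - s) + ‖x‖ ^ 2) ^ q *
        (1 + c / (K + γ * (τ - s) + ‖x‖ ^ 2))))
    (η := Real.exp (-(t - s)) * ((1 + γ * (t - s)) ^ q)⁻¹) hs (by positivity) ?_
    (fun x τ hτ => hder x τ hτ.1) ?_ ?_ ?_ ?_ x t ⟨ht, le_rfl⟩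
  · refine mul_le_one₀ (Real.exp_le_one_iff.2 (by linarith)) (by positivity) ?_
    exact inv_le_one_of_one_le₀ (Real.one_le_rpow
      (le_add_of_nonneg_right (by positivity)) hq.le)
  · intro x
    have hcont : Continuous fun τ => K + γ * (τ - s) + ‖x‖ ^ 2 := by fun_prop
    exact ((Real.continuous_exp.continuousOn).mul continuousOn_const).mul
      ((hcont.continuousOn.rpow_const fun τ hτ => Or.inl (hρ τ hτ.1 x).ne').mul
        (continuousOn_const.add (continuousOn_const.div hcont.continuousOn
          fun τ hτ => (hρ τ hτ.1 x).ne')))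
  · intro x τ hτ
    have h1 : (K + γ * (τ - s) + ‖x‖ ^ 2) ^ q ≤
        (1 + γ * (t - s)) ^ q * (K + ‖x‖ ^ 2) ^ q := by
      rw [← Real.mul_rpow (by positivity) (by positivity)]
      refine Real.rpow_le_rpow (hρ τ hτ.1 x).le ?_ hq.le
      have h2 : γ * (τ - s) ≤ γ * (t - s) := by gcongr; exact hτ.2
      have h3 : 0 ≤ γ * (t - s) := by positivity
      nlinarith [sq_nonneg ‖x‖]
    have h2 : Real.exp (-(t - s)) * Real.exp τ ≤ Real.exp s := by
      rw [← Real.exp_add]; exact Real.exp_le_exp.2 (by linarith [hτ.2])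
    have h4 : 0 < (1 + γ * (t - s)) ^ q := by positivity
    have h5 : 0 ≤ (K + γ * (τ - s) + ‖x‖ ^ 2) ^ q := Real.rpow_nonneg (hρ τ hτ.1 x).le q
    calc _ = (Real.exp (-(t - s)) * Real.exp τ) * b *
          (((1 + γ * (t - s)) ^ q)⁻¹ * (K + γ * (τ - s) + ‖x‖ ^ 2) ^ q) := by ring
      _ ≤ Real.exp s * b * (((1 + γ * (t - s)) ^ q)⁻¹ *
          ((1 + γ * (t - s)) ^ q * (K + ‖x‖ ^ 2) ^ q)) := by gcongr
      _ = _ := by rw [inv_mul_cancel_left₀ h4.ne']; simp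
  · intro x
    simpa using h0 x
  · intro β hβ hle x
    refine .of_forall fun τ hτ => ?_
    have hτ0 : 0 < τ := hs.trans_lt hτ.1
    have hcoef : 0 ≤ β * (Real.exp τ * b) := mul_nonneg hβ.1 (by positivity)
    have h1 := hsub (K + γ * (τ - s))
      (le_add_of_nonneg_right (mul_nonneg hγ0.le (sub_nonneg.2 hτ.1.le))) x
    have h2 := mul_le_mul_of_nonneg_left h1 hcoef
    rw [← besselPotential_const_mul] at h2
    have h3 := h2.trans (besselPotential_mono
      (fun y => mul_nonneg hcoef (Real.rpow_nonneg (hρ τ hτ.1.le y).le q))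
      (fun y => by
        have := hle y τ ⟨hτ.1.le, hτ.2⟩
        rw [mul_assoc]; exact this) (h.integrable_linear x hτ0.le))
    calc _ = β * (Real.exp τ * b) * ((K + γ * (τ - s) + ‖x‖ ^ 2) ^ q *
          (1 + c / (K + γ * (τ - s) + ‖x‖ ^ 2))) := by ring
      _ ≤ _ := h3
      _ ≤ _ := le_add_of_nonneg_right (h.source_nonneg hV0 x hτ0)

theorem exists_pointwise_lower_bound {n : ℕ} (hn : 1 ≤ n) {p : ℝ} (hp0 : 0 < p) (hp1 : p < 1)
    {σ : ℝ} (hσ : σ ∈ JPlus n) {Λ : ℝ → ℝ} (hΛc : ContinuousOn Λ (Ici 0))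
    (hΛpos : ∀ t > 0, 0 < Λ t) {V : EuclideanSpace ℝ (Fin n) → ℝ → ℝ}
    (hV0 : ∀ x, ∀ t > 0, 0 ≤ V x t) (hVlow : PotentialLowerBound n σ Λ V)
    (hε : 0 < σ → ∃ ε ∈ Ioo (0 : ℝ) 1, EpsAsymptoticBound ε Λ) :
    ∃ C > 0, ∃ T > 0, ∀ (u₀ : EuclideanSpace ℝ (Fin n) → ℝ)
      (u : EuclideanSpace ℝ (Fin n) → ℝ → ℝ),
      Continuous u₀ → (∀ x, 0 ≤ u₀ x) → u₀ ≠ 0 → IsGlobalSSolution n p V u₀ u →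
      ∀ t, T ≤ t → ∀ x, C * (primitive Λ t ^ (1 / (1 - p)) *
        (1 + t + ‖x‖ ^ 2) ^ (σ / (2 * (1 - p)))) ≤ u x t := by
  have hp : 0 < 1 - p := by linarith
  have hσ0 : 0 ≤ σ := by
    rcases hσ with h | h
    · exact le_of_eq (Eq.symm h)
    · exact (le_max_right _ _).trans h
  set q := σ / (2 * (1 - p)) with hq
  have hqcase : q = 0 ∨ 0 < q ∧ 2 - (n : ℝ) < 2 * q := by
    rcases hσ0.eq_or_lt with h | h
    · exact Or.inl (by rw [hq, ← h, zero_div])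
    · right
      have h1 : 2 - (n : ℝ) ≤ σ := by
        rcases hσ with h' | h'
        · exact absurd h' h.ne'
        · exact (le_max_left _ _).trans h'
      -- Division by `1 - p < 1` makes the inequality strict, so the endpoint `σ = 2 - n` is
      -- admitted.
      have h2 : σ < 2 * q := by
        rw [hq, show 2 * (σ / (2 * (1 - p))) = σ / (1 - p) by field_simp, lt_div_iff₀ hp]
        nlinarith
      exact ⟨by positivity, by linarith⟩
  obtain ⟨K, hK, c, hc0, hc, hsub⟩ := exists_weight_le_besselPotential hn hqcase
  obtain ⟨C, hC, hstat⟩ := exists_static_lower_bound hn hp0 hp1 hσ0 hΛc hΛpos hV0 hVlow hK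
    (fun x => le_trans (le_mul_of_one_le_right (by positivity)
      (le_add_of_nonneg_right (by positivity))) (hsub K le_rfl x))
  rcases hσ0.eq_or_lt with h0 | hσpos
  · have hq0 : q = 0 := by rw [hq, ← h0, zero_div]
    refine ⟨C, hC, 2, two_pos, fun u₀ u hu₀c hu₀0 hne hu t ht x => ?_⟩
    have h1 := hstat u₀ _ hu₀c hu₀0 hne hu t ht x
    rw [← hq, hq0, Real.rpow_zero, mul_one] at h1
    rw [hq0, Real.rpow_zero, mul_one]
    exact le_of_mul_le_mul_left h1 (Real.exp_pos t)
  · have hq0 : 0 < q := by positivity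
    obtain ⟨γ, hγ, hspread⟩ := exists_spreading hK hq0 (hc hq0) hsub
    obtain ⟨ε, ⟨hε0, hε1⟩, c', hc', t₀, ht₀, hE⟩ := hε hσpos
    set d := min 1 (γ * (1 - ε)) with hd
    have hd0 : 0 < d := lt_min one_pos (mul_pos hγ (by linarith))
    -- The bound `εt ≥ 2` allows the static estimate at time `εt`; spreading acts on the remaining
    -- time `(1-ε)t`, and `d` compares `K+γ(1-ε)t+‖x‖²` with `1+t+‖x‖²`.
    refine ⟨C * c' ^ (1 / (1 - p)) * d ^ q, by positivity, max (ε⁻¹ * t₀) (ε⁻¹ * 2),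
      lt_max_of_lt_left (by positivity), fun u₀ u hu₀c hu₀0 hne hu t ht x => ?_⟩
    have ht1 : ε⁻¹ * t₀ ≤ t := (le_max_left _ _).trans ht
    have ht2 : 2 ≤ ε * t := by
      have := (le_max_right _ _).trans ht
      rwa [inv_mul_le_iff₀ hε0] at this
    have ht0 : 0 < t := by
      by_contra h
      push Not at h
      nlinarith
    have hεt : ε * t ≤ t := mul_le_of_le_one_left ht0.le hε1.le
    have hP := primitive_pos hΛc hΛpos ht0
    have hPε := primitive_pos hΛc hΛpos (two_pos.trans_le ht2)
    have h1 := hspread hu hV0 (ε * t) (C * primitive Λ (ε * t) ^ (1 / (1 - p))) (by linarith)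
      (by positivity) (hstat u₀ _ hu₀c hu₀0 hne hu (ε * t) ht2) t hεt x
    rw [mul_assoc] at h1
    refine le_trans ?_ (le_of_mul_le_mul_left h1 (Real.exp_pos t))
    have h2 : c' ^ (1 / (1 - p)) * primitive Λ t ^ (1 / (1 - p)) ≤
        primitive Λ (ε * t) ^ (1 / (1 - p)) := by
      rw [← Real.mul_rpow hc'.le hP.le]
      exact Real.rpow_le_rpow (by positivity) (hE t ht1) (by positivity)
    have h3 : d ^ q * (1 + t + ‖x‖ ^ 2) ^ q ≤ (K + γ * (t - ε * t) + ‖x‖ ^ 2) ^ q := by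
      rw [← Real.mul_rpow hd0.le (by positivity)]
      refine Real.rpow_le_rpow (by positivity) ?_ hq0.le
      have h4 : d ≤ 1 := min_le_left _ _
      have h5 : d * t ≤ γ * (1 - ε) * t := by gcongr; exact min_le_right _ _
      have h6 : d * ‖x‖ ^ 2 ≤ ‖x‖ ^ 2 := mul_le_of_le_one_left (sq_nonneg _) h4
      linarith
    calc _ = C * (c' ^ (1 / (1 - p)) * primitive Λ t ^ (1 / (1 - p))) *
          (d ^ q * (1 + t + ‖x‖ ^ 2) ^ q) := by ring
      _ ≤ _ := by gcongr

/-! ### From pointwise bounds to weighted norms. -/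

theorem ofReal_le_weightedNorm {n : ℕ} {R a c : ℝ} (hR : 0 < R) (ha : 0 ≤ a) (hc : 0 ≤ c)
    {φ : EuclideanSpace ℝ (Fin n) → ℝ} (h : ∀ x, c ≤ φ x) :
    ENNReal.ofReal ((R ^ 2 + 1) ^ (-a / 2) * c) ≤ weightedNorm n R a φ := by
  rw [weightedNorm, eLpNorm_exponent_top]
  obtain ⟨y, hy, hle⟩ := Measure.exists_mem_of_measure_ne_zero_of_ae
    (Metric.measure_ball_pos (volume : Measure (EuclideanSpace ℝ (Fin n))) 0 one_pos).ne'
    (ae_restrict_of_ae (ae_le_eLpNormEssSup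
      (f := fun x : EuclideanSpace ℝ (Fin n) => (R ^ 2 + ‖x‖ ^ 2) ^ (-a / 2) * φ x)))
  refine le_trans ?_ hle
  have hy1 : ‖y‖ < 1 := by simpa using hy
  have h0 : 0 ≤ φ y := hc.trans (h y)
  rw [Real.enorm_of_nonneg (by positivity)]
  refine ENNReal.ofReal_le_ofReal (mul_le_mul ?_ (h y) hc (by positivity))
  refine Real.rpow_le_rpow_of_nonpos (by positivity) ?_ (by linarith)
  nlinarith [norm_nonneg y]

/-- A pointwise lower bound yields a lower bound for the weighted norm. -/
theorem ofReal_le_weightedNorm_of_forall {n : ℕ} {R a C P q t : ℝ} (hR : 0 < R) (ha : 0 ≤ a)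
    (hC : 0 ≤ C) (hP : 0 ≤ P) (hq : 0 ≤ q) (ht : 0 ≤ t) {φ : EuclideanSpace ℝ (Fin n) → ℝ}
    (h : ∀ x, C * (P * (1 + t + ‖x‖ ^ 2) ^ q) ≤ φ x) :
    ENNReal.ofReal (C * (R ^ 2 + 1) ^ (-a / 2) * (P * t ^ q)) ≤ weightedNorm n R a φ := by
  refine le_trans (le_of_eq ?_)
    (ofReal_le_weightedNorm (c := C * (P * t ^ q)) hR ha (by positivity) fun x => ?_)
  · congr 1; ring
  · refine le_trans ?_ (h x)
    have : t ^ q ≤ (1 + t + ‖x‖ ^ 2) ^ q :=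
      Real.rpow_le_rpow ht (by nlinarith [sq_nonneg ‖x‖]) hq
    gcongr

/-! ### Rates of the order of `t^k (log t)^ν`. -/

/-- The substitution `τ ↦ τ/2` bounds the integral of `Λ` over `[t/2, t]` by `2/b` times that over
`[t/4, t/2]`, so `Λ_*(t) ≤ (1+2/b)Λ_*(t/2)`. -/
theorem epsAsymptoticBound_half {Λ : ℝ → ℝ} (hΛc : ContinuousOn Λ (Ici 0))
    (hΛpos : ∀ t > 0, 0 < Λ t) {b t₀ : ℝ} (hb : 0 < b) (ht₀ : 0 < t₀)
    (h : ∀ t, t₀ ≤ t → b * Λ t ≤ Λ (t / 2)) : EpsAsymptoticBound (1 / 2) Λ := by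
  refine ⟨(1 + 2 / b)⁻¹, by positivity, t₀, ht₀, fun t ht => ?_⟩
  have ht2 : t₀ ≤ t / 2 := by norm_num at ht; linarith
  have ht0 : 0 < t := by linarith
  have hsub : ∀ {s : ℝ}, s ∈ Icc (t / 2) t → 0 ≤ s := fun hs => by linarith [hs.1]
  have h1 : primitive Λ t - primitive Λ (t / 2) ≤ ∫ τ in (t / 2)..t, b⁻¹ * Λ (τ / 2) := by
    rw [primitive_sub_eq_integral hΛc (by positivity) ht0.le]
    refine intervalIntegral.integral_mono_on (by linarith)
      (intervalIntegrable_of_continuousOn_Ici hΛc (by positivity) ht0.le) ?_ fun τ hτ => ?_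
    · refine ContinuousOn.intervalIntegrable (continuousOn_const.mul
        (hΛc.comp (by fun_prop) fun τ hτ => ?_))
      rw [uIcc_of_le (by linarith)] at hτ
      have := hsub hτ
      exact mem_Ici.2 (by positivity)
    · rw [← div_eq_inv_mul, le_div_iff₀' hb]
      exact h τ (ht2.trans hτ.1)
  have h2 : ∫ τ in (t / 2)..t, b⁻¹ * Λ (τ / 2) ≤ b⁻¹ * (2 * primitive Λ (t / 2)) := by
    rw [intervalIntegral.integral_const_mul,
      intervalIntegral.integral_comp_div (f := Λ) two_ne_zero, smul_eq_mul,
      ← primitive_sub_eq_integral hΛc (by positivity) (by positivity)]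
    have := primitive_pos hΛc hΛpos (show 0 < t / 2 / 2 by positivity)
    gcongr
    linarith
  rw [one_div_mul_eq_div, inv_mul_le_iff₀ (by positivity)]
  have h3 : b⁻¹ * (2 * primitive Λ (t / 2)) = 2 / b * primitive Λ (t / 2) := by ring
  linarith

/-- For `C ≥ M` the difference `CΛ_* - L` is nondecreasing on `[t₀, ∞)`; enlarging `C` makes it
nonnegative at `t₀`. -/
theorem exists_le_mul_primitive {Λ L L' : ℝ → ℝ} (hΛc : ContinuousOn Λ (Ici 0))
    (hΛpos : ∀ t > 0, 0 < Λ t) {M t₀ : ℝ} (ht₀ : 0 < t₀)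
    (hL : ∀ t, t₀ ≤ t → HasDerivAt L (L' t) t) (hle : ∀ t, t₀ ≤ t → L' t ≤ M * Λ t) :
    ∃ C > 0, ∀ t, t₀ ≤ t → L t ≤ C * primitive Λ t := by
  have hP := primitive_pos hΛc hΛpos ht₀
  set C := max 1 (max M (L t₀ / primitive Λ t₀)) with hC
  have hCM : M ≤ C := (le_max_left _ _).trans (le_max_right _ _)
  have hCL : L t₀ ≤ C * primitive Λ t₀ := by
    rw [← div_le_iff₀ hP]; exact (le_max_right _ _).trans (le_max_right _ _)
  refine ⟨C, lt_max_of_lt_left one_pos, fun t ht => ?_⟩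
  have hder : ∀ s ∈ Ici t₀, HasDerivAt (fun s => C * primitive Λ s - L s) (C * Λ s - L' s) s :=
    fun s hs => ((hasDerivAt_primitive hΛc (ht₀.trans_le hs)).const_mul C).sub (hL s hs)
  have hmono : MonotoneOn (fun s => C * primitive Λ s - L s) (Ici t₀) := by
    refine monotoneOn_of_deriv_nonneg (convex_Ici _)
      (fun s hs => (hder s hs).continuousAt.continuousWithinAt)
      (fun s hs => (hder s (interior_subset hs)).differentiableAt.differentiableWithinAt) ?_
    intro s hs
    have hs := interior_subset hs
    rw [(hder s hs).deriv]
    have h1 := hle s hs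
    have h2 := mul_le_mul_of_nonneg_right hCM (hΛpos s (ht₀.trans_le hs)).le
    linarith
  have := hmono (mem_Ici.2 le_rfl) ht ht
  simp only at this
  linarith

theorem one_lt_log_of_three_le {t : ℝ} (ht : 3 ≤ t) : 1 < Real.log t := by
  rw [Real.lt_log_iff_exp_lt (by linarith)]
  exact Real.exp_one_lt_three.trans_le ht

theorem exists_bounds_of_isTheta {Λ : ℝ → ℝ} (hΛpos : ∀ t > 0, 0 < Λ t) {k ν : ℝ}
    (h : Λ =Θ[atTop] fun t => t ^ k * Real.log t ^ ν) :
    ∃ c₁ > 0, ∃ c₂ > 0, ∃ t₀ ≥ (3 : ℝ), ∀ t, t₀ ≤ t →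
      t ^ k * Real.log t ^ ν ≤ c₁ * Λ t ∧ Λ t ≤ c₂ * (t ^ k * Real.log t ^ ν) := by
  obtain ⟨c₂, hc₂, h2⟩ := h.1.exists_pos
  obtain ⟨c₁, hc₁, h1⟩ := h.2.exists_pos
  obtain ⟨t₁, ht₁⟩ := eventually_atTop.1 (h1.bound.and h2.bound)
  refine ⟨c₁, hc₁, c₂, hc₂, max t₁ 3, le_max_right _ _, fun t ht => ?_⟩
  have ht3 : 3 ≤ t := (le_max_right _ _).trans ht
  have hlog := one_lt_log_of_three_le ht3
  have hΛt := hΛpos t (by linarith)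
  have hf : 0 ≤ t ^ k * Real.log t ^ ν := by positivity
  have := ht₁ t ((le_max_left _ _).trans ht)
  rwa [Real.norm_of_nonneg hΛt.le, Real.norm_of_nonneg hf] at this

theorem epsAsymptoticBound_of_isTheta {Λ : ℝ → ℝ} (hΛc : ContinuousOn Λ (Ici 0))
    (hΛpos : ∀ t > 0, 0 < Λ t) {k ν : ℝ} (h : Λ =Θ[atTop] fun t => t ^ k * Real.log t ^ ν) :
    EpsAsymptoticBound (1 / 2) Λ := by
  obtain ⟨c₁, hc₁, c₂, hc₂, t₀, ht₀, hb⟩ := exists_bounds_of_isTheta hΛpos h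
  set m := min 1 ((1 / 2 : ℝ) ^ ν) with hm
  have hm0 : 0 < m := lt_min one_pos (by positivity)
  refine epsAsymptoticBound_half hΛc hΛpos (b := (c₁ * c₂)⁻¹ * ((1 / 2) ^ k * m)) (t₀ := 2 * t₀)
    (by positivity) (by positivity) fun t ht => ?_
  have ht0 : 0 < t := by linarith
  have hl := one_lt_log_of_three_le (show 3 ≤ t by linarith)
  have hl2 := one_lt_log_of_three_le (show 3 ≤ t / 2 by linarith)
  have hlog : Real.log (t / 2) = Real.log t - Real.log 2 := Real.log_div ht0.ne' two_ne_zero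
  have hlog2 : Real.log 2 < 1 := by
    have := Real.log_two_lt_d9; linarith
  have hratio : m * Real.log t ^ ν ≤ Real.log (t / 2) ^ ν := by
    have hlog2' : 0 < Real.log 2 := Real.log_pos one_lt_two
    rcases le_total 0 ν with hν | hν
    · calc m * Real.log t ^ ν ≤ (1 / 2) ^ ν * Real.log t ^ ν := by
            gcongr; exact min_le_right _ _
        _ = (1 / 2 * Real.log t) ^ ν := by rw [Real.mul_rpow (by norm_num) (by linarith)]
        _ ≤ _ := Real.rpow_le_rpow (by linarith) (by linarith) hν
    · calc m * Real.log t ^ ν ≤ 1 * Real.log t ^ ν := by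
            gcongr; exact min_le_left _ _
        _ = Real.log t ^ ν := one_mul _
        _ ≤ _ := Real.rpow_le_rpow_of_nonpos (by linarith) (by linarith) hν
  have hpow : (t / 2) ^ k = (1 / 2) ^ k * t ^ k := by
    rw [← Real.mul_rpow (by norm_num) ht0.le]; congr 1; ring
  have h1 := (hb (t / 2) (by linarith)).1
  have h2 := (hb t (by linarith)).2
  rw [hpow] at h1
  have h3 : (1 / 2) ^ k * m * Λ t ≤ c₁ * c₂ * Λ (t / 2) := by
    calc (1 / 2) ^ k * m * Λ t ≤ (1 / 2) ^ k * m * (c₂ * (t ^ k * Real.log t ^ ν)) := by gcongr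
      _ = c₂ * ((1 / 2) ^ k * t ^ k * (m * Real.log t ^ ν)) := by ring
      _ ≤ c₂ * ((1 / 2) ^ k * t ^ k * Real.log (t / 2) ^ ν) := by gcongr
      _ ≤ c₂ * (c₁ * Λ (t / 2)) := by gcongr
      _ = _ := by ring
  rw [mul_assoc, inv_mul_le_iff₀ (by positivity)]
  exact h3

theorem logPowerPrimitive_of_neg_one_lt {k ν t : ℝ} (hk : -1 < k) (ht : 3 ≤ t) :
    logPowerPrimitive k ν t = t ^ (k + 1) * Real.log t ^ ν := by
  have hl := one_lt_log_of_three_le ht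
  have hk1 : k + 1 ≠ 0 := by linarith
  rw [logPowerPrimitive, if_neg (fun h => by linarith [h.1]), if_neg (by linarith),
    max_eq_left (by linarith), Real.mul_rpow (by linarith) (by positivity),
    ← Real.rpow_mul (by linarith), div_mul_cancel₀ _ hk1]

theorem exists_logPowerPrimitive_le {Λ : ℝ → ℝ} (hΛc : ContinuousOn Λ (Ici 0))
    (hΛpos : ∀ t > 0, 0 < Λ t) {k ν : ℝ} (h : Λ =Θ[atTop] fun t => t ^ k * Real.log t ^ ν) :
    ∃ C > 0, ∃ T ≥ (3 : ℝ), ∀ t, T ≤ t → logPowerPrimitive k ν t ≤ C * primitive Λ t := by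
  obtain ⟨c₁, -, c₂, -, t₀, ht₀, hb⟩ := exists_bounds_of_isTheta hΛpos h
  suffices hs : ∃ L L' : ℝ → ℝ, ∃ M : ℝ, (∀ t, 3 ≤ t → logPowerPrimitive k ν t = L t) ∧
      (∀ t, 3 ≤ t → HasDerivAt L (L' t) t) ∧
      ∀ t, t₀ ≤ t → L' t ≤ M * Λ t by
    obtain ⟨L, L', M, h1, h2, h3⟩ := hs
    obtain ⟨C, hC, hle⟩ := exists_le_mul_primitive hΛc hΛpos (by linarith : 0 < t₀)
      (fun t ht => h2 t (ht₀.trans ht)) h3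
    exact ⟨C, hC, t₀, ht₀, fun t ht => (h1 t (ht₀.trans ht)).trans_le (hle t ht)⟩
  -- In the convergent cases the positive part in the exponent vanishes, so the rate is the constant
  -- 1 and only `Λ_* > 0` matters.
  have hconst : (∀ t, 3 ≤ t → logPowerPrimitive k ν t = 1) →
      ∃ L L' : ℝ → ℝ, ∃ M : ℝ, (∀ t, 3 ≤ t → logPowerPrimitive k ν t = L t) ∧
      (∀ t, 3 ≤ t → HasDerivAt L (L' t) t) ∧ ∀ t, t₀ ≤ t → L' t ≤ M * Λ t := fun h1 =>
    ⟨fun _ => 1, fun _ => 0, 0, h1, fun t _ => hasDerivAt_const t 1, fun t _ => by simp⟩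
  rcases lt_trichotomy k (-1) with hk | hk | hk
  · refine hconst fun t _ => ?_
    rw [logPowerPrimitive, if_neg (fun h => hk.ne h.1), if_neg hk.ne,
      max_eq_right (by linarith), Real.rpow_zero]
  · rcases lt_trichotomy ν (-1) with hν | hν | hν
    · refine hconst fun t _ => ?_
      rw [logPowerPrimitive, if_neg (fun h => hν.ne h.2), if_pos hk,
        max_eq_right (by linarith), Real.rpow_zero]
    · refine ⟨fun t => Real.log (Real.log t), fun t => t⁻¹ / Real.log t, c₁, fun t _ => ?_,
        fun t ht => ?_, fun t ht => ?_⟩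
      · rw [logPowerPrimitive, if_pos ⟨hk, hν⟩]
      · have hl := one_lt_log_of_three_le ht
        exact (Real.hasDerivAt_log (by linarith)).log (by linarith)
      · refine le_trans (le_of_eq ?_) (hb t ht).1
        rw [hk, hν, Real.rpow_neg_one, Real.rpow_neg_one]
        exact div_eq_mul_inv _ _
    · refine ⟨fun t => Real.log t ^ (ν + 1), fun t => t⁻¹ * (ν + 1) * Real.log t ^ (ν + 1 - 1),
        (ν + 1) * c₁, fun t _ => ?_, fun t ht => ?_, fun t ht => ?_⟩
      · rw [logPowerPrimitive, if_neg (fun h => hν.ne' h.2), if_pos hk,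
          max_eq_left (by linarith)]
      · have hl := one_lt_log_of_three_le ht
        exact (Real.hasDerivAt_log (by linarith)).rpow_const (Or.inl (by linarith))
      · have := mul_le_mul_of_nonneg_left (hb t ht).1 (by linarith : 0 ≤ ν + 1)
        rw [hk, Real.rpow_neg_one] at this
        rw [add_sub_cancel_right]
        linarith
  · refine ⟨fun t => t ^ (k + 1) * Real.log t ^ ν,
      fun t => (k + 1) * t ^ (k + 1 - 1) * Real.log t ^ ν +
        t ^ (k + 1) * (t⁻¹ * ν * Real.log t ^ (ν - 1)), (k + 1 + |ν|) * c₁,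
      fun t ht => logPowerPrimitive_of_neg_one_lt hk ht, fun t ht => ?_, fun t ht => ?_⟩
    · have hl := one_lt_log_of_three_le ht
      exact (Real.hasDerivAt_rpow_const (Or.inl (by linarith))).mul
        ((Real.hasDerivAt_log (by linarith)).rpow_const (Or.inl (by linarith)))
    · have hl := one_lt_log_of_three_le (ht₀.trans ht)
      have ht0 : 0 < t := by linarith
      have h1 := mul_le_mul_of_nonneg_left (hb t ht).1
        (show 0 ≤ k + 1 + |ν| from add_nonneg (by linarith) (abs_nonneg ν))
      beta_reduce
      rw [add_sub_cancel_right, Real.rpow_add_one ht0.ne']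
      -- Since `log t > 1` for `t ≥ 3`, the derivative falling on the logarithm is absorbed into the
      -- main term, at the cost of `|ν|` in the constant.
      have h2 : Real.log t ^ (ν - 1) ≤ Real.log t ^ ν :=
        Real.rpow_le_rpow_of_exponent_le hl.le (by linarith)
      have h3 : t ^ k * t * (t⁻¹ * ν * Real.log t ^ (ν - 1)) =
          t ^ k * (ν * Real.log t ^ (ν - 1)) := by field_simp
      have h4 : ν * Real.log t ^ (ν - 1) ≤ |ν| * Real.log t ^ ν := by
        have : 0 ≤ Real.log t ^ (ν - 1) := by positivity
        calc _ ≤ |ν| * Real.log t ^ (ν - 1) := by gcongr; exact le_abs_self ν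
          _ ≤ _ := by gcongr
      have h5 : t ^ k * (ν * Real.log t ^ (ν - 1)) ≤ t ^ k * (|ν| * Real.log t ^ ν) := by gcongr
      rw [h3]
      linarith

theorem logPowerPrimitive_nonneg {k ν t : ℝ} (ht : 3 ≤ t) : 0 ≤ logPowerPrimitive k ν t := by
  have hl := one_lt_log_of_three_le ht
  rw [logPowerPrimitive]
  split_ifs
  · exact (Real.log_pos hl).le
  · positivity
  · have : 0 < t := by linarith
    positivity

theorem logPowerGrowUp_eq {p σ k ν t : ℝ} (hp1 : p < 1) (ht : 3 ≤ t) :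
    logPowerGrowUp p σ k ν t =
      logPowerPrimitive k ν t ^ (1 / (1 - p)) * t ^ (σ / (2 * (1 - p))) := by
  have hl := one_lt_log_of_three_le ht
  have ht0 : 0 < t := by linarith
  have hp : 1 - p ≠ 0 := by linarith
  by_cases h1 : k = -1 ∧ ν = -1
  · rw [logPowerGrowUp, logPowerPrimitive, if_pos h1, if_pos h1]
  by_cases h2 : k = -1
  · rw [logPowerGrowUp, logPowerPrimitive, if_neg h1, if_neg h1, if_pos h2, if_pos h2,
      ← Real.rpow_mul (by linarith), mul_one_div]
  rcases lt_or_gt_of_ne h2 with hk | hk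
  · rw [logPowerGrowUp, logPowerPrimitive, if_neg h1, if_neg h1, if_neg h2, if_neg h2,
      if_neg (by linarith), max_eq_right (by linarith)]
    simp
  · rw [logPowerPrimitive_of_neg_one_lt hk ht, logPowerGrowUp, if_neg h1, if_neg h2, if_pos hk,
      max_eq_left (by linarith), Real.mul_rpow (by positivity) (by positivity),
      ← Real.rpow_mul ht0.le, ← Real.rpow_mul (by linarith), mul_one_div, mul_one_div,
      mul_right_comm, ← Real.rpow_add ht0]
    congr 2
    field_simp
    ring

/-! ### The two parts of the theorem. -/

theorem mainTheorem3 (n : ℕ) (hn : 1 ≤ n) (p : ℝ) (hp0 : 0 < p) (hp1 : p < 1)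
    (σ : ℝ) (hσ : σ ∈ JPlus n)
    (Λ : ℝ → ℝ) (hΛc : ContinuousOn Λ (Ici 0)) (hΛpos : ∀ t > 0, 0 < Λ t)
    (V : EuclideanSpace ℝ (Fin n) → ℝ → ℝ)
    (hVc : ContinuousOn (fun z : EuclideanSpace ℝ (Fin n) × ℝ => V z.1 z.2) (univ ×ˢ Ioi 0))
    (hV0 : ∀ x, ∀ t > 0, 0 ≤ V x t)
    (hVlow : PotentialLowerBound n σ Λ V)
    (a : ℝ) (ha : max σ 0 / (1 - p) ≤ a) (R : ℝ) (hR : 0 < R) :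
    ((0 < σ → ∃ ε ∈ Ioo (0 : ℝ) 1, EpsAsymptoticBound ε Λ) →
      ∃ C > 0, ∃ T > 0, ∀ (u₀ : EuclideanSpace ℝ (Fin n) → ℝ)
        (u : EuclideanSpace ℝ (Fin n) → ℝ → ℝ),
        Continuous u₀ → (∀ x, 0 ≤ u₀ x) → u₀ ≠ 0 → IsGlobalSSolution n p V u₀ u →
        ∀ t, T ≤ t →
          (∀ x, C * (primitive Λ t ^ (1 / (1 - p)) *
              (1 + t + ‖x‖ ^ 2) ^ (σ / (2 * (1 - p)))) ≤ u x t) ∧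
          ENNReal.ofReal (C * (primitive Λ t ^ (1 / (1 - p)) * t ^ (σ / (2 * (1 - p))))) ≤
            weightedNorm n R a (fun x => u x t)) ∧
    (∀ k ν : ℝ, Λ =Θ[atTop] (fun t => t ^ k * Real.log t ^ ν) →
      ∃ C > 0, ∃ T > 0, ∀ (u₀ : EuclideanSpace ℝ (Fin n) → ℝ)
        (u : EuclideanSpace ℝ (Fin n) → ℝ → ℝ),
        Continuous u₀ → (∀ x, 0 ≤ u₀ x) → u₀ ≠ 0 → IsGlobalSSolution n p V u₀ u →
        ∀ t, T ≤ t →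
          (∀ x, C * (logPowerPrimitive k ν t ^ (1 / (1 - p)) *
              (1 + t + ‖x‖ ^ 2) ^ (σ / (2 * (1 - p)))) ≤ u x t) ∧
          ENNReal.ofReal (C * logPowerGrowUp p σ k ν t) ≤
            weightedNorm n R a (fun x => u x t)) := by
  have hσ0 : 0 ≤ σ := by
    rcases hσ with h | h
    · exact le_of_eq (Eq.symm h)
    · exact (le_max_right _ _).trans h
  have hp : 0 < 1 - p := by linarith
  have ha0 : 0 ≤ a := (div_nonneg (le_max_right σ 0) hp.le).trans ha
  have hq0 : 0 ≤ σ / (2 * (1 - p)) := by positivity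
  set κ := (R ^ 2 + 1) ^ (-a / 2) with hκ
  have hκ0 : 0 < κ := by positivity
  -- Because `κ ≤ 1`, one constant serves for the pointwise bound and for the norm bound.
  have hκ1 : κ ≤ 1 := Real.rpow_le_one_of_one_le_of_nonpos
    (le_add_of_nonneg_left (sq_nonneg R)) (by linarith)
  constructor
  · intro hε
    obtain ⟨C, hC, T, hT, h⟩ := exists_pointwise_lower_bound hn hp0 hp1 hσ hΛc hΛpos hV0 hVlow hε
    refine ⟨C * κ, by positivity, T, hT, fun u₀ u hu₀c hu₀0 hne hu t ht => ?_⟩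
    have ht0 : 0 < t := hT.trans_le ht
    have hP := primitive_pos hΛc hΛpos ht0
    have hpt := h u₀ u hu₀c hu₀0 hne hu t ht
    refine ⟨fun x => le_trans ?_ (hpt x), ofReal_le_weightedNorm_of_forall hR ha0 hC.le
      (by positivity) hq0 ht0.le hpt⟩
    exact mul_le_mul_of_nonneg_right (mul_le_of_le_one_right hC.le hκ1) (by positivity)
  · intro k ν hΘ
    obtain ⟨C, hC, T, hT, h⟩ := exists_pointwise_lower_bound hn hp0 hp1 hσ hΛc hΛpos hV0 hVlow
      fun _ => ⟨1 / 2, by norm_num, epsAsymptoticBound_of_isTheta hΛc hΛpos hΘ⟩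
    obtain ⟨B, hB, T', hT', hle⟩ := exists_logPowerPrimitive_le hΛc hΛpos hΘ
    set D := C * (B ^ (1 / (1 - p)))⁻¹ with hD
    have hD0 : 0 < D := by positivity
    refine ⟨D * κ, by positivity, max T T', lt_max_of_lt_left hT,
      fun u₀ u hu₀c hu₀0 hne hu t ht => ?_⟩
    have ht3 : 3 ≤ t := hT'.trans ((le_max_right _ _).trans ht)
    have ht0 : 0 < t := by linarith
    have hP := primitive_pos hΛc hΛpos ht0
    have hL := logPowerPrimitive_nonneg (k := k) (ν := ν) ht3
    have hLP : logPowerPrimitive k ν t ^ (1 / (1 - p)) ≤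
        B ^ (1 / (1 - p)) * primitive Λ t ^ (1 / (1 - p)) := by
      rw [← Real.mul_rpow hB.le hP.le]
      exact Real.rpow_le_rpow hL (hle t ((le_max_right _ _).trans ht)) (by positivity)
    have hpt : ∀ x, D * (logPowerPrimitive k ν t ^ (1 / (1 - p)) *
        (1 + t + ‖x‖ ^ 2) ^ (σ / (2 * (1 - p)))) ≤ u x t := fun x => by
      refine le_trans ?_ (h u₀ u hu₀c hu₀0 hne hu t ((le_max_left _ _).trans ht) x)
      rw [hD, mul_assoc]
      refine mul_le_mul_of_nonneg_left ?_ hC.le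
      rw [inv_mul_le_iff₀ (by positivity), ← mul_assoc]
      gcongr
    refine ⟨fun x => le_trans ?_ (hpt x), ?_⟩
    · exact mul_le_mul_of_nonneg_right (mul_le_of_le_one_right hD0.le hκ1) (by positivity)
    · rw [logPowerGrowUp_eq hp1 ht3]
      exact ofReal_le_weightedNorm_of_forall hR ha0 hD0.le (by positivity) hq0 ht0.le hpt
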